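/- For $d\ge 0$ let $LX_d=\mathbb{CP}^{5d+4}$ be the projective space of $5$-tuples $(x_1(\zeta),\dots,x_5(\zeta))$ of complex polynomials of degree $\le d$, with the circle action induced by $\zeta\mapsto \zeta e^{i\phi}$. Let $\hbar$ be the generator of $H^*(BS^1)$, and let $-p$ be the $S^1$-equivariant first Chern class of the Hopf (tautological) line bundle, normalized so that $p$ restricts to $m\hbar$ at the fixed points where only coefficients of $\zeta^m$ are non-zero. Let $LV_d$ be the equivariant bundle of rank $5d+1$ over $LX_d$ of polynomials of degree $\le 5d$ in $\zeta$ twisted by $\mathcal O(5)$, so that $\mathrm{Euler}(LV_d)=\prod_{k=0}^{5d}(5p-k\hbar)$. Put $$L(q,z):=\sum_{d\ge 0} q^d\int_{LX_d} e^{pz}\,\mathrm{Euler}(LV_d),$$ a formal power series in $q,z$ whose coefficients are polynomials in $\hbar$; the integral is evaluation of equivariant cohomology classes on the fundamental class. In the algebra generated by $P$ with the relation $P^4=0$ let $$\langle\phi,\psi\rangle:=\int_{\mathbb{CP}^4}\phi\,\psi\,\mathrm{Euler}(\mathcal O(5))=\frac1{2\pi i}\oint \phi(P)\psi(P)\frac{5P\,dP}{P^5}$$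 (five times the coefficient of $P^3$ in $\phi\psi$), and let $$I(q,\hbar^{-1}):=e^{P\ln q/\hbar}\sum_{d\ge 0}q^d\,\frac{\prod_{m=1}^{5d}(5P+m\hbar)}{\prod_{m=1}^{d}(P+m\hbar)^5},$$ a formal power series in $q$ whose coefficients are polynomials in $\ln q$ over $\mathbb Q(\hbar)[P]/(P^4)$, where $\ln q$ is a formal variable with $q\frac{d}{dq}\ln q=1$ and the substitution $q\mapsto qe^{\hbar z}$ sends $\ln q$ to $\ln q+\hbar z$. Then the two expressions for $\langle\phi,\psi\rangle$ agree, and: (a) $L(q,z)=\langle I(qe^{\hbar z},\hbar^{-1}),\,I(q,-\hbar^{-1})\rangle$, where the pairing is extended coefficientwise (in particular the right-hand side does not contain $\ln q$ and its coefficients are polynomials in $\hbar$). (b) The four components of $I$ (the coefficients of $1,P,P^2,P^3$) form a fundamental solution of the linear differential equation $$\Big(q\frac{d}{dq}\Big)^4 f=5q\Big(5q\frac{d}{dq}+1\Big)\Big(5q\frac{d}{dq}+2\Big)\Big(5q\frac{d}{dq}+3\Big)\Big(5q\frac{d}{dq}+4\Big)f,$$ that is, they are linearly independent over the field of constants and span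 the space of all its solutions among power series in $q$ with coefficients polynomial in $\ln q$. This holds over every field of constants $K$ of characteristic zero, for $\hbar$ any non-zero element of $K$ (for example $K=\mathbb Q(\hbar)$). -/

import Mathlib

namespace QuinticMirror

open Polynomial PowerSeries MeasureTheory

noncomputable section

/-! ### Equivariant differential forms on complex projective space

`ℂP^N` is the space of lines in `ℂ^(N+1)`.  The circle acts on `ℂ^(N+1)`, hence on `ℂP^N`, by
multiplying the `j`-th homogeneous coordinate by `exp (i t w_j)`.  Equivariant cohomology classes
are represented by equivariant differential forms (the Cartan model): polynomials in the generator
`ħ` of `H^*(BS¹)` whose coefficients are differential forms.  Forms on `ℂP^N` are written in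
homogeneous coordinates, that is, they are pulled back to `ℂ^(N+1) ∖ {0}`. -/

/-- The space `ℂ^(N+1)` of homogeneous coordinates on `ℂP^N`. -/
abbrev HomCoord (N : ℕ) : Type := Fin (N + 1) → ℂ

/-- Values of differential forms: the exterior algebra of the real cotangent space. -/
abbrev Form (N : ℕ) : Type := ExteriorAlgebra ℝ (HomCoord N →L[ℝ] ℝ)

/-- Equivariant differential forms: polynomials in `ħ` (the polynomial variable) whose
coefficients are fields of differential forms; multiplication is the wedge product. -/
abbrev EquivForm (N : ℕ) : Type := Polynomial (HomCoord N → Form N)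

/-- The coordinate covector `d (Re x_j)`. -/
def dRe {N : ℕ} (j : Fin (N + 1)) : HomCoord N →L[ℝ] ℝ :=
  Complex.reCLM.comp (ContinuousLinearMap.proj j)

/-- The coordinate covector `d (Im x_j)`. -/
def dIm {N : ℕ} (j : Fin (N + 1)) : HomCoord N →L[ℝ] ℝ :=
  Complex.imCLM.comp (ContinuousLinearMap.proj j)

/-- The exterior derivative of a 1-form, `∑ dx_a ∧ ∂_a θ` over the real coordinates `x_a`. -/
def extD {N : ℕ} (θ : HomCoord N → (HomCoord N →L[ℝ] ℝ)) : HomCoord N → Form N := fun x =>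
  ∑ j : Fin (N + 1),
    (ExteriorAlgebra.ι ℝ (dRe j) * ExteriorAlgebra.ι ℝ (fderiv ℝ θ x (Pi.single j 1)) +
      ExteriorAlgebra.ι ℝ (dIm j) * ExteriorAlgebra.ι ℝ (fderiv ℝ θ x (Pi.single j Complex.I)))

/-- The connection 1-form `Im ⟨x, dx⟩ / (2π ‖x‖²)` of the Hopf bundle `ℂ^(N+1) ∖ {0} → ℂP^N`
with its standard Hermitian metric. -/
def hopfConnection {N : ℕ} (x : HomCoord N) : HomCoord N →L[ℝ] ℝ :=
  (2 * Real.pi * ∑ j, Complex.normSq (x j))⁻¹ • ∑ j, ((x j).re • dIm j - (x j).im • dRe j)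

/-- The circle action with weights `w`. -/
def rotate {N : ℕ} (w : Fin (N + 1) → ℕ) (t : ℝ) (x : HomCoord N) : HomCoord N :=
  fun j => Complex.exp (Complex.I * t * w j) * x j

/-- The vector field generating the circle action with weights `w`. -/
def generator {N : ℕ} (w : Fin (N + 1) → ℕ) (x : HomCoord N) : HomCoord N :=
  deriv (fun t : ℝ => rotate w t x) 0

/-- The generator `ħ` of `H^*(BS¹)`, as an equivariant form. -/
def hbarForm {N : ℕ} : EquivForm N := Polynomial.X

/-- The equivariant form representing the class `p`, where `-p` is the equivariant first Chern
class of the Hopf (tautological) line bundle: it is the equivariant curvature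
`dθ + 2π ħ θ(ξ)` of the invariant connection form `θ`, with `ξ` the generating vector field.  The
normalization is such that `p` is Poincaré dual to a hyperplane when `ħ = 0`, and that it restricts
to `w_j ħ` at the fixed point where only the `j`-th coordinate is non-zero. -/
def pForm {N : ℕ} (w : Fin (N + 1) → ℕ) : EquivForm N :=
  Polynomial.C (extD hopfConnection) +
    Polynomial.C (fun x =>
      algebraMap ℝ (Form N) (2 * Real.pi * hopfConnection x (generator w x))) * hbarForm

/-- Evaluation of (the degree `m` component of) a form on the vectors `v 0, …, v (m - 1)`;
on a product of covectors it is `det (φ_i (v_j))`. -/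
def evalForm {N m : ℕ} (v : Fin m → HomCoord N) : Form N →ₗ[ℝ] ℝ :=
  ExteriorAlgebra.liftAlternating (R := ℝ) (Pi.single m
    ((Matrix.detRowAlternating (R := ℝ) (n := Fin m)).compLinearMap
      (LinearMap.pi fun j =>
        (ContinuousLinearMap.coeLM ℝ : (HomCoord N →L[ℝ] ℝ) →ₗ[ℝ] (HomCoord N →ₗ[ℝ] ℝ)).flip
          (v j))))

/-- The affine chart `u ↦ [1 : u_1 : … : u_N]` of `ℂP^N`, with complement of measure zero. -/
def chart {N : ℕ} (u : Fin N → ℂ) : HomCoord N := Fin.cons 1 u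

/-- The oriented real frame `e_1, i e_1, …, e_N, i e_N` of the affine chart. -/
def chartFrame (N : ℕ) (a : Fin (N * 2)) : HomCoord N :=
  Pi.single (finProdFinEquiv.symm a).1.succ (if (finProdFinEquiv.symm a).2 = 0 then 1 else Complex.I)

/-- The integral over `ℂP^N` of (the top-degree component of) a differential form. -/
def projIntegral {N : ℕ} (α : HomCoord N → Form N) : ℝ :=
  ∫ u : Fin N → ℂ, evalForm (chartFrame N) (α (chart u))

/-- The integral over `ℂP^N` of an equivariant form, with values in `H^*(BS¹) = ℝ[ħ]`. -/
def equivIntegral {N : ℕ} (α : EquivForm N) : ℝ[X] :=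
  α.sum fun k a => Polynomial.monomial k (projIntegral a)

/-! ### The linear sigma-model

`LX_d = ℂP^(5d+4)` is the projective space of 5-tuples of polynomials of degree `≤ d` in `ζ`;
the homogeneous coordinate with index `5 k + i`, `0 ≤ i < 5`, is the coefficient of `ζ^k` in the
`i`-th polynomial.  The circle acts by `ζ ↦ ζ exp (i t)`. -/

/-- The weights of the circle action on `LX_d`: the coefficients of `ζ^k` have weight `k`. -/
def sigmaWeight (d : ℕ) (a : Fin (5 * d + 4 + 1)) : ℕ := (a : ℕ) / 5

/-- The class `p` on `LX_d`. -/
def pLX (d : ℕ) : EquivForm (5 * d + 4) := pForm (sigmaWeight d)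

/-- The equivariant Euler class of the bundle `LV_d` of rank `5d+1` over `LX_d`, whose fibres are
the polynomials of degree `≤ 5d` in `ζ` twisted by `𝒪(5)`.  It is the direct sum of the line
bundles of coefficients of `ζ^k`, `0 ≤ k ≤ 5d`, with equivariant Chern classes `5p - kħ`. -/
def eulerLV (d : ℕ) : EquivForm (5 * d + 4) :=
  ((List.range (5 * d + 1)).map fun k => 5 * pLX d - (k : EquivForm (5 * d + 4)) * hbarForm).prod

/-- The series `L(q, z) = ∑ q^d ∫_{LX_d} e^{pz} Euler(LV_d)`; the outer power series variable is
`q`, the inner one is `z`, and the coefficients are polynomials in `ħ`. -/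
def LSeries : ℝ[X]⟦X⟧⟦X⟧ :=
  PowerSeries.mk fun d => PowerSeries.mk fun n =>
    equivIntegral (((n.factorial : ℝ)⁻¹ • pLX d ^ n) * eulerLV d)

/-! ### The cohomology algebra of the quintic and the hypergeometric series -/

/-- The algebra `K[P]/(P^4)`. -/
abbrev QuinticAlg (K : Type*) [Field K] : Type _ := AdjoinRoot (Polynomial.X ^ 4 : K[X])

/-- The generator `P`. -/
def clsP (K : Type*) [Field K] : QuinticAlg K := AdjoinRoot.root (Polynomial.X ^ 4 : K[X])

/-- The coefficient of `P^j` (`j < 4`) of an element of `K[P]/(P^4)`. -/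
def comp {K : Type*} [Field K] (j : ℕ) : QuinticAlg K →ₗ[K] K :=
  (Polynomial.lcoeff K j).comp (AdjoinRoot.modByMonicHom (Polynomial.monic_X_pow 4))

/-- The functional `φ ↦ ∫_{ℂP^4} φ Euler(𝒪(5)) = Res φ(P) 5P dP / P^5`: five times the
coefficient of `P^3`. -/
def quinticInt {K : Type*} [Field K] : QuinticAlg K →ₗ[K] K := (5 : K) • comp 3

/-- The intersection pairing on `K[P]/(P^4)`. -/
def pairing {K : Type*} [Field K] (φ ψ : QuinticAlg K) : K := quinticInt (φ * ψ)

/-- A linear functional on `K[P]/(P^4)` applied to the coefficients of a polynomial in `ℓ`. -/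
def polyMap {K : Type*} [Field K] (f : QuinticAlg K →ₗ[K] K) (g : (QuinticAlg K)[X]) : K[X] :=
  g.sum fun n a => Polynomial.monomial n (f a)

/-- The intersection pairing extended coefficientwise to power series in `q` (outer variable) and
`z` (inner variable) whose coefficients are polynomials in `ℓ = ln q` over `K[P]/(P^4)`. -/
def pairingSeries {K : Type*} [Field K] (φ ψ : (QuinticAlg K)[X]⟦X⟧⟦X⟧) : K[X]⟦X⟧⟦X⟧ :=
  PowerSeries.mk fun d => PowerSeries.mk fun n =>
    polyMap quinticInt (PowerSeries.coeff n (PowerSeries.coeff d (φ * ψ)))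

/-- The factor `e^{P ℓ / h}`, `ℓ = ln q`, a polynomial in `ℓ` because `P^4 = 0`. -/
def expLog {K : Type*} [Field K] (h : K) : (QuinticAlg K)[X] :=
  ∑ j ∈ Finset.range 4,
    Polynomial.monomial j (algebraMap K (QuinticAlg K) ((j.factorial : K)⁻¹ * h⁻¹ ^ j) * clsP K ^ j)

/-- The coefficient
`(5P + h)(5P + 2h)⋯(5P + 5dh) / ((P + h)^5 (P + 2h)^5 ⋯ (P + dh)^5)` in `K[P]/(P^4)`. The
denominator is a unit whenever `h ≠ 0` and `K` has characteristic zero. -/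
def hyperCoeff {K : Type*} [Field K] (h : K) (d : ℕ) : QuinticAlg K :=
  (∏ m ∈ Finset.Icc 1 (5 * d), (5 * clsP K + algebraMap K (QuinticAlg K) (m * h))) *
    Ring.inverse (∏ m ∈ Finset.Icc 1 d, (clsP K + algebraMap K (QuinticAlg K) (m * h)) ^ 5)

/-- The hypergeometric series `I(q, h⁻¹)`, a power series in `q` whose coefficients are
polynomials in `ℓ = ln q` over `K[P]/(P^4)`. -/
def ISeries {K : Type*} [Field K] (h : K) : (QuinticAlg K)[X]⟦X⟧ :=
  PowerSeries.C (expLog h) * PowerSeries.mk fun d => Polynomial.C (hyperCoeff h d)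

/-- The power series `e^{a z}` in `z`. -/
def expZ {K : Type*} [Field K] (a : K) : (QuinticAlg K)[X]⟦X⟧ :=
  PowerSeries.mk fun n => algebraMap K (QuinticAlg K)[X] ((n.factorial : K)⁻¹ * a ^ n)

/-- The substitution `q ↦ q e^{hz}` in `f(q, ln q)`: `q^d ↦ q^d e^{dhz}` and `ℓ ↦ ℓ + hz`. -/
def shiftQ {K : Type*} [Field K] (h : K) (f : (QuinticAlg K)[X]⟦X⟧) :
    (QuinticAlg K)[X]⟦X⟧⟦X⟧ :=
  PowerSeries.mk fun d =>
    (PowerSeries.coeff d f).eval₂ (PowerSeries.C.comp Polynomial.C)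
      (PowerSeries.C Polynomial.X +
        PowerSeries.C (algebraMap K (QuinticAlg K)[X] h) * PowerSeries.X) *
    expZ (d * h)

/-- A series in `q` regarded as a series in `q` and `z` that does not depend on `z`. -/
def constZ {K : Type*} [Field K] (f : (QuinticAlg K)[X]⟦X⟧) : (QuinticAlg K)[X]⟦X⟧⟦X⟧ :=
  PowerSeries.map PowerSeries.C f

/-! ### The differential equation -/

/-- The operator `q d/dq` on power series in `q` with coefficients polynomial in `ℓ = ln q`. -/
def qDeriv (K : Type*) [Field K] : Module.End K K[X]⟦X⟧ where
  toFun f := PowerSeries.mk fun d =>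
    (d : K) • PowerSeries.coeff d f + Polynomial.derivative (PowerSeries.coeff d f)
  map_add' f g := by
    ext1 d
    simp only [map_add, smul_add, PowerSeries.coeff_mk]
    abel
  map_smul' c f := by
    ext1 d
    simp only [PowerSeries.coeff_mk, PowerSeries.coeff_smul, RingHom.id_apply,
      Polynomial.derivative_smul, smul_add, smul_comm c]

/-- Multiplication by `q`. -/
def mulQ (K : Type*) [Field K] : Module.End K K[X]⟦X⟧ :=
  LinearMap.mulLeft K (PowerSeries.X : K[X]⟦X⟧)

/-- The space of solutions of the fourth-order equation
`(q d/dq)^4 f = 5q (5q d/dq + 1)(5q d/dq + 2)(5q d/dq + 3)(5q d/dq + 4) f`. -/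
def solutionSpace (K : Type*) [Field K] : Submodule K K[X]⟦X⟧ :=
  LinearMap.ker (qDeriv K ^ 4 -
    5 * mulQ K * (5 * qDeriv K + 1) * (5 * qDeriv K + 2) * (5 * qDeriv K + 3) * (5 * qDeriv K + 4))

/-- The components of `I`: the coefficients of `1, P, P^2, P^3`. -/
def IComponent {K : Type*} [Field K] (h : K) (j : Fin 4) : K[X]⟦X⟧ :=
  PowerSeries.mk fun d => polyMap (comp j) (PowerSeries.coeff d (ISeries h))

end

end QuinticMirror

/-!
In a chart, the powers of `p` integrate over `ℂP^N` as moments of the Fubini–Study measure, which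
are the complete homogeneous symmetric polynomials in the weights `w_j ħ`. Hence the integral of a
polynomial `F(p)` is the residue at infinity of `F(p) / ∏_j (p - w_j ħ)`, that is, the coefficient
of highest degree of the remainder of `F` modulo the denominator.

On `LX_d` the denominator is `∏_{k ≤ d} (p - kħ)^5`. The Euler class of `LV_d` cancels one factor of
each fifth power, and the residue theorem leaves a sum over `k ≤ d` of residues of order four at
`p = P + kħ`, `P^4 = 0`. There the factors of the integrand with index above and below `k` separate,
which gives `e^{(P + kħ)z}` times five times the product of the `k`-th coefficient of `I(q, ħ⁻¹)`
and the `(d - k)`-th coefficient of `I(q, -ħ⁻¹)`; this is the pairing.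

For the differential equation, `q d/dq` acts on `e^{P ln q / ħ} q^d` as multiplication by `d + P/ħ`,
and the coefficients of `I` satisfy the recursion which the equation imposes. A solution is
determined by its coefficient of `q^0`, a polynomial of degree at most three in `ln q`, because
`d + d/dℓ` is injective on polynomials in `ℓ` for `d ≠ 0`.
-/

namespace QuinticMirror

open Polynomial PowerSeries MeasureTheory

noncomputable section

/-! ### Powers of sums of square-zero elements -/

section SquareZero

variable {R ι : Type*} [CommRing R]

theorem add_pow_succ_of_sq_eq_zero {a : R} (ha : a ^ 2 = 0) (b : R) (n : ℕ) :
    (a + b) ^ (n + 1) = b ^ (n + 1) + (n + 1) * a * b ^ n := by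
  induction n with
  | zero => rw [Nat.cast_zero]; ring
  | succ n ih =>
    rw [pow_succ, ih]
    push_cast
    linear_combination ((n : R) + 1) * b ^ n * ha

theorem sum_pow_of_sq_eq_zero {t : ι → R} (ht : ∀ j, t j ^ 2 = 0) (s : Finset ι) (n : ℕ) :
    (∑ j ∈ s, t j) ^ n = n.factorial * ∑ u ∈ s.powersetCard n, ∏ j ∈ u, t j := by
  classical
  induction s using Finset.induction_on generalizing n with
  | empty =>
    cases n with
    | zero => simp
    | succ n => rw [Finset.powersetCard_eq_empty.mpr (by simp)]; simp
  | insert i s hi ih =>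
    cases n with
    | zero => simp
    | succ n =>
      have notMem_of_mem : ∀ u ∈ s.powersetCard n, i ∉ u := fun u hu hiu =>
        hi ((Finset.mem_powersetCard.mp hu).1 hiu)
      have disjoint : Disjoint (s.powersetCard (n + 1)) ((s.powersetCard n).image (insert i)) := by
        refine Finset.disjoint_right.mpr fun u hu hus => ?_
        obtain ⟨v, -, rfl⟩ := Finset.mem_image.mp hu
        exact hi ((Finset.mem_powersetCard.mp hus).1 (Finset.mem_insert_self i v))
      have sum_image : ∑ u ∈ (s.powersetCard n).image (insert i), ∏ j ∈ u, t j =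
          t i * ∑ u ∈ s.powersetCard n, ∏ j ∈ u, t j := by
        rw [Finset.sum_image (Finset.insert_erase_invOn.2.injOn.mono notMem_of_mem),
          Finset.mul_sum]
        exact Finset.sum_congr rfl fun u hu => Finset.prod_insert (notMem_of_mem u hu)
      rw [Finset.sum_insert hi, add_pow_succ_of_sq_eq_zero (ht i), ih, ih,
        Finset.powersetCard_succ_insert hi, Finset.sum_union disjoint, sum_image,
        Nat.factorial_succ]
      push_cast
      ring

theorem sum_powersetCard_card_pred_prod [Fintype ι] [DecidableEq ι] (t : ι → R) {n : ℕ}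
    (hn : Fintype.card ι = n + 1) :
    ∑ u ∈ Finset.univ.powersetCard n, ∏ j ∈ u, t j = ∑ i, ∏ j ∈ Finset.univ.erase i, t j := by
  refine (Finset.sum_bij (fun i _ => Finset.univ.erase i) (fun i _ => ?_) (fun i _ j _ h => ?_)
    (fun u hu => ?_) fun _ _ => rfl).symm
  · rw [Finset.mem_powersetCard_univ, Finset.card_erase_of_mem (Finset.mem_univ i),
      Finset.card_univ, hn, Nat.add_sub_cancel]
  · exact (Finset.erase_inj _ (Finset.mem_univ i)).mp h
  · have card_compl : uᶜ.card = 1 := by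
      rw [Finset.card_compl, (Finset.mem_powersetCard_univ.mp hu), hn, Nat.add_sub_cancel_left]
    obtain ⟨i, hi⟩ := Finset.card_eq_one.mp card_compl
    exact ⟨i, Finset.mem_univ i, by rw [← Finset.compl_singleton, ← hi, compl_compl]⟩

-- Only the terms of degree at most one in `T` survive, as in the matrix determinant lemma.
theorem smul_sum_sub_smul_pow_card {k : Type*} [Field k] [Algebra k R] [Fintype ι] [DecidableEq ι]
    {t : ι → R} {T : R} {c : ι → k} (ht : ∀ j, t j ^ 2 = 0) (hT : T ^ 2 = 0)
    (htT : ∀ j, (∏ i ∈ Finset.univ.erase j, t i) * T = c j • ∏ i, t i)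
    (hc : 1 + ∑ j, c j ≠ 0) :
    ((1 + ∑ j, c j)⁻¹ • ∑ j, t j - ((1 + ∑ j, c j) ^ 2)⁻¹ • T) ^ Fintype.card ι =
      ((Fintype.card ι).factorial / (1 + ∑ j, c j) ^ (Fintype.card ι + 1) : k) • ∏ j, t j := by
  set r := 1 + ∑ j, c j with hr
  obtain hι | ⟨n, hn⟩ : Fintype.card ι = 0 ∨ ∃ n, Fintype.card ι = n + 1 :=
    (Nat.eq_zero_or_eq_succ_pred _).imp_right fun h => ⟨_, h⟩
  · have := Fintype.card_eq_zero_iff.mp hι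
    simp [hr]
  have factor : r⁻¹ • ∑ j, t j - (r ^ 2)⁻¹ • T = r⁻¹ • (-(r⁻¹ • T) + ∑ j, t j) := by
    rw [smul_add, smul_neg, smul_smul, sq, mul_inv]; abel
  have sq_zero : (-(r⁻¹ • T)) ^ 2 = 0 := by rw [neg_sq, _root_.smul_pow, hT, smul_zero]
  have pow_succ_sum : (∑ j, t j) ^ (n + 1) = ((n + 1).factorial : k) • ∏ j, t j := by
    rw [sum_pow_of_sq_eq_zero ht, ← hn, ← Finset.card_univ, Finset.powersetCard_self,
      Finset.sum_singleton, Algebra.smul_def, map_natCast]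
  have pow_sum : T * (∑ j, t j) ^ n = (n.factorial * (r - 1) : k) • ∏ j, t j := by
    rw [sum_pow_of_sq_eq_zero ht, sum_powersetCard_card_pred_prod t hn, mul_left_comm, mul_comm T,
      Finset.sum_mul, Finset.sum_congr rfl fun j _ => htT j, ← Finset.sum_smul, hr,
      add_sub_cancel_left, mul_smul, Algebra.smul_def (n.factorial : k), map_natCast]
  calc (r⁻¹ • ∑ j, t j - (r ^ 2)⁻¹ • T) ^ Fintype.card ι
      = (r⁻¹) ^ (n + 1) • ((∑ j, t j) ^ (n + 1) - ((n + 1 : k) * r⁻¹) • (T * (∑ j, t j) ^ n)) := by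
        rw [hn, factor, _root_.smul_pow, add_pow_succ_of_sq_eq_zero sq_zero, Algebra.smul_def r⁻¹ T,
          Algebra.smul_def ((n + 1 : k) * r⁻¹)]
        congr 1
        simp only [map_mul, map_add, map_natCast, map_one]
        ring
    _ = ((r⁻¹) ^ (n + 1) * ((n + 1).factorial - (n + 1) * r⁻¹ * (n.factorial * (r - 1)))) •
          ∏ j, t j := by
        rw [pow_succ_sum, pow_sum, smul_smul, ← sub_smul, smul_smul]
    _ = _ := by
        rw [hn, Nat.factorial_succ]
        congr 1
        push_cast
        rw [inv_pow]
        field_simp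
        ring

end SquareZero

/-! ### Exterior algebra -/

section Exterior

variable {R M : Type*} [CommRing R] [AddCommGroup M] [Module R M]

open ExteriorAlgebra (ι)

theorem ι_mul_ι_comm_neg (a b : M) : ι R a * ι R b = -(ι R b * ι R a) :=
  eq_neg_of_add_eq_zero_left (ExteriorAlgebra.ι_add_mul_swap a b)

theorem ι_mul_ι_mem_center (a b : M) :
    ι R a * ι R b ∈ Subalgebra.center R (ExteriorAlgebra R M) := by
  rw [Subalgebra.mem_center_iff]
  intro x
  induction x using ExteriorAlgebra.induction with
  | algebraMap r => exact Algebra.commutes r _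
  | ι m =>
    rw [← mul_assoc, ι_mul_ι_comm_neg m a, neg_mul, mul_assoc, ι_mul_ι_comm_neg m b, mul_neg,
      neg_neg, mul_assoc]
  | mul x y hx hy => rw [mul_assoc, hy, ← mul_assoc, hx, mul_assoc]
  | add x y hx hy => rw [add_mul, mul_add, hx, hy]

/-- The product `a ∧ b` of two covectors. It is bundled as an element of the centre of the exterior
algebra, so that identities between such products can be proved in a commutative ring. -/
def wedge (R : Type*) {M : Type*} [CommRing R] [AddCommGroup M] [Module R M] (a b : M) :
    Subalgebra.center R (ExteriorAlgebra R M) :=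
  ⟨ι R a * ι R b, ι_mul_ι_mem_center a b⟩

theorem coe_wedge (a b : M) : (wedge R a b : ExteriorAlgebra R M) = ι R a * ι R b := rfl

theorem wedge_mul_ι_left (a b : M) : (wedge R a b : ExteriorAlgebra R M) * ι R a = 0 := by
  rw [coe_wedge, mul_assoc, ι_mul_ι_comm_neg b a, mul_neg, ← mul_assoc, ExteriorAlgebra.ι_sq_zero,
    zero_mul, neg_zero]

theorem wedge_mul_ι_right (a b : M) : (wedge R a b : ExteriorAlgebra R M) * ι R b = 0 := by
  rw [coe_wedge, mul_assoc, ExteriorAlgebra.ι_sq_zero, mul_zero]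

theorem wedge_sq (a b : M) : wedge R a b ^ 2 = 0 := by
  apply Subtype.ext
  rw [sq, MulMemClass.coe_mul, coe_wedge a b, ← mul_assoc, ← coe_wedge a b, wedge_mul_ι_left,
    zero_mul, ZeroMemClass.coe_zero]

theorem ι_mul_ι_linearCombination (a b : M) (x y z w : R) :
    ι R (x • a + y • b) * ι R (z • a + w • b) = (x * w - y * z) • (ι R a * ι R b) := by
  simp only [map_add, map_smul, add_mul, mul_add, smul_mul_assoc, mul_smul_comm,
    ExteriorAlgebra.ι_sq_zero, ι_mul_ι_comm_neg b a]
  module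

variable {κ : Type*} [Fintype κ] [DecidableEq κ] (e f : κ → M)

theorem prod_erase_wedge_mul_ι_sum (x y : κ → R) (j : κ) :
    ((∏ k ∈ Finset.univ.erase j, wedge R (e k) (f k) : Subalgebra.center R _) :
        ExteriorAlgebra R M) * ι R (∑ k, (x k • e k + y k • f k)) =
      (∏ k ∈ Finset.univ.erase j, wedge R (e k) (f k) : Subalgebra.center R _) *
        ι R (x j • e j + y j • f j) := by
  rw [map_sum, Finset.mul_sum, Finset.sum_eq_single_of_mem j (Finset.mem_univ j)]
  intro k _ hkj
  rw [← Finset.prod_erase_mul _ _ (Finset.mem_erase.mpr ⟨hkj, Finset.mem_univ k⟩),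
    MulMemClass.coe_mul, mul_assoc, map_add, map_smul, map_smul, mul_add, mul_smul_comm,
    mul_smul_comm, wedge_mul_ι_left, wedge_mul_ι_right, smul_zero, smul_zero, add_zero, mul_zero]

theorem prod_erase_wedge_mul_wedge_sum (x y z w : κ → R) (j : κ) :
    (∏ k ∈ Finset.univ.erase j, wedge R (e k) (f k)) *
        wedge R (∑ k, (x k • e k + y k • f k)) (∑ k, (z k • e k + w k • f k)) =
      (x j * w j - y j * z j) • ∏ k, wedge R (e k) (f k) := by
  set Q := ∏ k ∈ Finset.univ.erase j, wedge R (e k) (f k)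
  have Q_comm : ∀ a : ExteriorAlgebra R M, a * Q = Q * a := Subalgebra.mem_center_iff.mp Q.2
  rw [← Finset.prod_erase_mul _ _ (Finset.mem_univ j), ← mul_smul_comm]
  apply Subtype.ext
  calc (Q : ExteriorAlgebra R M) *
        (ι R (∑ k, (x k • e k + y k • f k)) * ι R (∑ k, (z k • e k + w k • f k)))
      = ι R (x j • e j + y j • f j) * (Q * ι R (∑ k, (z k • e k + w k • f k))) := by
        rw [← mul_assoc, prod_erase_wedge_mul_ι_sum, ← Q_comm, mul_assoc]
    _ = Q * (ι R (x j • e j + y j • f j) * ι R (z j • e j + w j • f j)) := by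
        rw [prod_erase_wedge_mul_ι_sum, ← mul_assoc, Q_comm, mul_assoc]
    _ = Q * ((x j * w j - y j * z j) • (ι R (e j) * ι R (f j))) := by
        rw [ι_mul_ι_linearCombination]

/-- The coefficient of a form on `R^m` on the standard volume form. -/
def topForm (R : Type*) [CommRing R] (m : ℕ) : ExteriorAlgebra R (Fin m → R) →ₗ[R] R :=
  ExteriorAlgebra.liftAlternating (Pi.single m Matrix.detRowAlternating)

theorem topForm_ιMulti_single (m : ℕ) :
    topForm R m (ExteriorAlgebra.ιMulti R m fun a => Pi.single a 1) = 1 := by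
  have single_eq_one : (fun a : Fin m => Pi.single a (1 : R)) = (1 : Matrix (Fin m) (Fin m) R) := by
    ext i j
    rw [Matrix.one_eq_pi_single]
  rw [topForm, ExteriorAlgebra.liftAlternating_apply_ιMulti, Pi.single_eq_same, single_eq_one]
  exact Matrix.det_one

/-- The standard basis of `R^(2N)`, grouped into pairs. -/
def pairBasis (R : Type*) [CommRing R] {N : ℕ} (j : Fin N) (b : Fin 2) : Fin (N * 2) → R :=
  Pi.single (finProdFinEquiv (j, b)) 1

theorem topForm_prod_wedge_pairBasis (N : ℕ) :
    topForm R (N * 2) (∏ j : Fin N, wedge R (pairBasis R j 0) (pairBasis R j 1) :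
      Subalgebra.center R (ExteriorAlgebra R (Fin (N * 2) → R))) = 1 := by
  rw [← topForm_ιMulti_single, ExteriorAlgebra.ιMulti_apply, List.ofFn_mul, List.prod_flatten,
    ← List.prod_ofFn, ← Subalgebra.coe_val, map_list_prod, List.map_ofFn, List.map_ofFn]
  congr 3
  ext j
  have index (b : Fin 2) : finProdFinEquiv (j, b) = ⟨(j : ℕ) * 2 + b, by omega⟩ :=
    Fin.ext (by simp only [finProdFinEquiv_apply_val]; ring)
  simp [coe_wedge, pairBasis, index]

end Exterior

/-! ### The Fubini–Study form -/

section FubiniStudy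

open ExteriorAlgebra (ι)

variable {N : ℕ}

theorem dRe_apply (j : Fin (N + 1)) (x : HomCoord N) : dRe j x = (x j).re := rfl

theorem dIm_apply (j : Fin (N + 1)) (x : HomCoord N) : dIm j x = (x j).im := rfl

/-- The 1-form `Re ⟨x, dx⟩`, depending linearly on `x`. -/
def reInner : HomCoord N →L[ℝ] (HomCoord N →L[ℝ] ℝ) :=
  ∑ j, ((dRe j).smulRight (dRe j) + (dIm j).smulRight (dIm j))

/-- The 1-form `Im ⟨x, dx⟩`, depending linearly on `x`. -/
def imInner : HomCoord N →L[ℝ] (HomCoord N →L[ℝ] ℝ) :=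
  ∑ j, ((dRe j).smulRight (dIm j) - (dIm j).smulRight (dRe j))

theorem reInner_apply (x : HomCoord N) :
    reInner x = ∑ j, ((x j).re • dRe j + (x j).im • dIm j) := by
  simp [reInner, dRe_apply, dIm_apply]

theorem imInner_apply (x : HomCoord N) :
    imInner x = ∑ j, ((x j).re • dIm j - (x j).im • dRe j) := by
  simp [imInner, dRe_apply, dIm_apply]

theorem imInner_single (j : Fin (N + 1)) (c : ℂ) :
    imInner (Pi.single j c) = c.re • dIm j - c.im • dRe j := by
  rw [imInner_apply, Finset.sum_eq_single_of_mem j (Finset.mem_univ j), Pi.single_eq_same]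
  intro k _ hk
  simp [Pi.single_eq_of_ne hk]

theorem hopfConnection_apply (x : HomCoord N) :
    hopfConnection x = (2 * Real.pi * ∑ j, Complex.normSq (x j))⁻¹ • imInner x := by
  rw [imInner_apply]
  rfl

theorem hasFDerivAt_sum_normSq (x : HomCoord N) :
    HasFDerivAt (fun x : HomCoord N => ∑ j, Complex.normSq (x j)) ((2 : ℝ) • reInner x) x := by
  have hasFDerivAt_normSq (j : Fin (N + 1)) :
      HasFDerivAt (fun x : HomCoord N => Complex.normSq (x j))
        ((2 : ℝ) • ((x j).re • dRe j + (x j).im • dIm j)) x := by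
    have hRe := (dRe (N := N) j).hasFDerivAt (x := x)
    have hIm := (dIm (N := N) j).hasFDerivAt (x := x)
    refine ((hRe.mul hRe).add (hIm.mul hIm)).congr_fderiv ?_
    simp only [dRe_apply, dIm_apply]
    module
  refine (HasFDerivAt.fun_sum fun j _ => hasFDerivAt_normSq j).congr_fderiv ?_
  rw [reInner_apply, Finset.smul_sum]

theorem sum_apply_smul_dRe_add_dIm (φ : HomCoord N →L[ℝ] ℝ) :
    ∑ j, (φ (Pi.single j 1) • dRe j + φ (Pi.single j Complex.I) • dIm j) = φ := by
  ext x
  have decomp : x = ∑ j, ((x j).re • (Pi.single j 1 : HomCoord N) +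
      (x j).im • (Pi.single j Complex.I : HomCoord N)) := by
    conv_lhs => rw [← Finset.univ_sum_single x]
    refine Finset.sum_congr rfl fun j _ => ?_
    rw [← Pi.single_smul, ← Pi.single_smul, ← Pi.single_add]
    congr 1
    simp
  conv_rhs => rw [decomp, map_sum]
  simp [dRe_apply, dIm_apply, mul_comm]

theorem extD_smul {g : HomCoord N → ℝ} {g' : HomCoord N →L[ℝ] ℝ}
    {θ : HomCoord N → (HomCoord N →L[ℝ] ℝ)} {x : HomCoord N} (hg : HasFDerivAt g g' x)
    (hθ : DifferentiableAt ℝ θ x) :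
    extD (fun y => g y • θ y) x = ι ℝ g' * ι ℝ (θ x) + g x • extD θ x := by
  simp only [extD, (hg.fun_smul hθ.hasFDerivAt).fderiv, add_apply,
    smul_apply, ContinuousLinearMap.smulRight_apply, map_add, map_smul, mul_add, mul_smul_comm,
    Finset.smul_sum]
  conv_rhs => rw [← sum_apply_smul_dRe_add_dIm g', map_sum, Finset.sum_mul]
  rw [← Finset.sum_add_distrib]
  refine Finset.sum_congr rfl fun j _ => ?_
  simp only [map_add, map_smul, add_mul, smul_mul_assoc, smul_add]
  abel

theorem extD_imInner (x : HomCoord N) :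
    extD imInner x = (2 : ℝ) • ∑ j, ι ℝ (dRe j) * ι ℝ (dIm j) := by
  simp only [extD, ContinuousLinearMap.fderiv, imInner_single, Complex.one_re, Complex.one_im,
    Complex.I_re, Complex.I_im, one_smul, zero_smul, sub_zero, zero_sub, map_neg, mul_neg,
    ι_mul_ι_comm_neg (dIm _) (dRe _), neg_neg, Finset.smul_sum, two_smul]

theorem extD_hopfConnection {x : HomCoord N} (hx : ∑ j, Complex.normSq (x j) ≠ 0) :
    extD hopfConnection x =
      Real.pi⁻¹ • ((∑ j, Complex.normSq (x j))⁻¹ • ∑ j, ι ℝ (dRe j) * ι ℝ (dIm j) -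
        ((∑ j, Complex.normSq (x j)) ^ 2)⁻¹ • (ι ℝ (reInner x) * ι ℝ (imInner x))) := by
  have hpi := Real.pi_ne_zero
  have hasFDerivAt_inv := (hasDerivAt_inv (mul_ne_zero (mul_ne_zero two_ne_zero hpi) hx))
    |>.comp_hasFDerivAt x ((hasFDerivAt_sum_normSq x).const_mul (2 * Real.pi))
  have key := extD_smul hasFDerivAt_inv (imInner (N := N)).differentiableAt
  rw [show hopfConnection = _ from funext hopfConnection_apply]
  refine key.trans ?_
  rw [extD_imInner]
  simp only [map_smul, smul_mul_assoc, smul_smul, smul_sub, Function.comp_apply]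
  rw [add_comm, sub_eq_add_neg, ← neg_smul]
  congr 2 <;> field_simp

/-- The values of a covector on a family of vectors. -/
def restrictCovector {m : ℕ} (v : Fin m → HomCoord N) : (HomCoord N →L[ℝ] ℝ) →ₗ[ℝ] (Fin m → ℝ) :=
  LinearMap.pi fun j =>
    (ContinuousLinearMap.coeLM ℝ : (HomCoord N →L[ℝ] ℝ) →ₗ[ℝ] (HomCoord N →ₗ[ℝ] ℝ)).flip (v j)

theorem restrictCovector_apply {m : ℕ} (v : Fin m → HomCoord N) (φ : HomCoord N →L[ℝ] ℝ)
    (j : Fin m) : restrictCovector v φ j = φ (v j) := rfl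

theorem evalForm_eq_topForm_map {m : ℕ} (v : Fin m → HomCoord N) (α : Form N) :
    evalForm v α = topForm ℝ m (ExteriorAlgebra.map (restrictCovector v) α) := by
  suffices evalForm v =
      topForm ℝ m ∘ₗ (ExteriorAlgebra.map (restrictCovector v)).toLinearMap from
    LinearMap.congr_fun this α
  refine ExteriorAlgebra.lhom_ext fun n => ?_
  ext w
  simp only [LinearMap.compAlternatingMap_apply, LinearMap.comp_apply, AlgHom.toLinearMap_apply,
    ExteriorAlgebra.map_apply_ιMulti, evalForm, topForm,
    ExteriorAlgebra.liftAlternating_apply_ιMulti]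
  obtain rfl | hnm := eq_or_ne n m
  · rw [Pi.single_eq_same, Pi.single_eq_same]
    rfl
  · simp only [Pi.single_eq_of_ne hnm, AlternatingMap.zero_apply]

theorem evalForm_eq_zero_of_mem {m n : ℕ} (v : Fin m → HomCoord N) (h : n ≠ m) {α : Form N}
    (hα : α ∈ ⋀[ℝ]^n (HomCoord N →L[ℝ] ℝ)) : evalForm v α = 0 := by
  rw [← ExteriorAlgebra.ιMulti_span_fixedDegree] at hα
  induction hα using Submodule.span_induction with
  | mem x hx =>
    obtain ⟨w, rfl⟩ := hx
    rw [evalForm, ExteriorAlgebra.liftAlternating_apply_ιMulti, Pi.single_eq_of_ne h,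
      AlternatingMap.zero_apply]
  | zero => exact map_zero _
  | add x y _ _ hx hy => rw [map_add, hx, hy, add_zero]
  | smul c x _ hx => rw [map_smul, hx, smul_zero]

theorem extD_mem_exteriorPower_two (θ : HomCoord N → (HomCoord N →L[ℝ] ℝ)) (x : HomCoord N) :
    extD θ x ∈ ⋀[ℝ]^2 (HomCoord N →L[ℝ] ℝ) := by
  have ι_mul_ι_mem (a b : HomCoord N →L[ℝ] ℝ) :
      ι ℝ a * ι ℝ b ∈ ⋀[ℝ]^2 (HomCoord N →L[ℝ] ℝ) := by
    rw [ExteriorAlgebra.exteriorPower, sq]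
    exact Submodule.mul_mem_mul ⟨a, rfl⟩ ⟨b, rfl⟩
  exact Submodule.sum_mem _ fun j _ => Submodule.add_mem _ (ι_mul_ι_mem _ _) (ι_mul_ι_mem _ _)

theorem evalForm_extD_pow_eq_zero {m n : ℕ} (v : Fin m → HomCoord N) (h : 2 * n ≠ m)
    (θ : HomCoord N → (HomCoord N →L[ℝ] ℝ)) (x : HomCoord N) :
    evalForm v (extD θ x ^ n) = 0 := by
  apply evalForm_eq_zero_of_mem v h
  rw [ExteriorAlgebra.exteriorPower, pow_mul]
  exact Submodule.pow_mem_pow _ (extD_mem_exteriorPower_two θ x) n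

theorem restrictCovector_chartFrame_dRe_zero : restrictCovector (chartFrame N) (dRe 0) = 0 := by
  ext a
  simp [restrictCovector_apply, chartFrame, dRe_apply]

theorem restrictCovector_chartFrame_dIm_zero : restrictCovector (chartFrame N) (dIm 0) = 0 := by
  ext a
  simp [restrictCovector_apply, chartFrame, dIm_apply]

theorem restrictCovector_chartFrame_dRe_succ (j : Fin N) :
    restrictCovector (chartFrame N) (dRe j.succ) = pairBasis ℝ j 0 := by
  ext a
  obtain ⟨⟨k, b⟩, rfl⟩ := finProdFinEquiv.surjective a
  simp only [restrictCovector_apply, chartFrame, dRe_apply, pairBasis, Equiv.symm_apply_apply]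
  rw [Pi.single_apply, Pi.single_apply]
  fin_cases b <;> simp [eq_comm, apply_ite Complex.re]

theorem restrictCovector_chartFrame_dIm_succ (j : Fin N) :
    restrictCovector (chartFrame N) (dIm j.succ) = pairBasis ℝ j 1 := by
  ext a
  obtain ⟨⟨k, b⟩, rfl⟩ := finProdFinEquiv.surjective a
  simp only [restrictCovector_apply, chartFrame, dIm_apply, pairBasis, Equiv.symm_apply_apply]
  rw [Pi.single_apply, Pi.single_apply]
  fin_cases b <;> simp [eq_comm, apply_ite Complex.im]

theorem restrictCovector_reInner_chart (u : Fin N → ℂ) :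
    restrictCovector (chartFrame N) (reInner (chart u)) =
      ∑ j, ((u j).re • pairBasis ℝ j 0 + (u j).im • pairBasis ℝ j 1) := by
  rw [reInner_apply, map_sum, Fin.sum_univ_succ]
  simp only [map_add, map_smul, restrictCovector_chartFrame_dRe_zero,
    restrictCovector_chartFrame_dIm_zero, restrictCovector_chartFrame_dRe_succ,
    restrictCovector_chartFrame_dIm_succ, chart, Fin.cons_succ, smul_zero, zero_add]

theorem restrictCovector_imInner_chart (u : Fin N → ℂ) :
    restrictCovector (chartFrame N) (imInner (chart u)) =
      ∑ j, (-(u j).im • pairBasis ℝ j 0 + (u j).re • pairBasis ℝ j 1) := by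
  rw [imInner_apply, map_sum, Fin.sum_univ_succ]
  simp only [map_sub, map_smul, restrictCovector_chartFrame_dRe_zero,
    restrictCovector_chartFrame_dIm_zero, restrictCovector_chartFrame_dRe_succ,
    restrictCovector_chartFrame_dIm_succ, chart, Fin.cons_succ, smul_zero, zero_add, sub_zero]
  simp only [neg_smul, sub_eq_neg_add]

theorem sum_normSq_chart (u : Fin N → ℂ) :
    ∑ j, Complex.normSq (chart u j) = 1 + ∑ j, Complex.normSq (u j) := by
  simp [Fin.sum_univ_succ, chart]

theorem sum_normSq_chart_pos (u : Fin N → ℂ) : 0 < ∑ j, Complex.normSq (chart u j) := by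
  rw [sum_normSq_chart]
  have := Finset.sum_nonneg fun j (_ : j ∈ Finset.univ) => Complex.normSq_nonneg (u j)
  linarith

theorem map_restrictCovector_extD_hopfConnection (u : Fin N → ℂ) :
    ExteriorAlgebra.map (restrictCovector (chartFrame N)) (extD hopfConnection (chart u)) =
      (Real.pi⁻¹ • ((1 + ∑ j, Complex.normSq (u j))⁻¹ •
          ∑ j, wedge ℝ (pairBasis ℝ j 0) (pairBasis ℝ j 1) -
        ((1 + ∑ j, Complex.normSq (u j)) ^ 2)⁻¹ •
          wedge ℝ (∑ j, ((u j).re • pairBasis ℝ j 0 + (u j).im • pairBasis ℝ j 1))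
            (∑ j, (-(u j).im • pairBasis ℝ j 0 + (u j).re • pairBasis ℝ j 1))) :
        Subalgebra.center ℝ (ExteriorAlgebra ℝ (Fin (N * 2) → ℝ))) := by
  rw [extD_hopfConnection (sum_normSq_chart_pos u).ne', sum_normSq_chart, map_smul, map_sub,
    map_smul, map_smul, map_sum, Fin.sum_univ_succ]
  push_cast
  simp only [coe_wedge, map_mul, ExteriorAlgebra.map_apply_ι, restrictCovector_chartFrame_dRe_zero,
    restrictCovector_chartFrame_dRe_succ, restrictCovector_chartFrame_dIm_succ,
    restrictCovector_reInner_chart, restrictCovector_imInner_chart, map_zero, zero_mul, zero_add]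

theorem evalForm_extD_hopfConnection_pow (u : Fin N → ℂ) :
    evalForm (chartFrame N) (extD hopfConnection (chart u) ^ N) =
      N.factorial / Real.pi ^ N / (1 + ∑ j, Complex.normSq (u j)) ^ (N + 1) := by
  have normSq_pos : 1 + ∑ j, Complex.normSq (u j) ≠ 0 :=
    (sum_normSq_chart u ▸ sum_normSq_chart_pos u).ne'
  have prod_erase_mul (j : Fin N) := prod_erase_wedge_mul_wedge_sum (R := ℝ)
    (fun j => pairBasis ℝ j 0) (fun j => pairBasis ℝ j 1) (fun j => (u j).re) (fun j => (u j).im)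
    (fun j => -(u j).im) (fun j => (u j).re) j
  simp only [mul_neg, sub_neg_eq_add, ← Complex.normSq_apply] at prod_erase_mul
  have pow_card := smul_sum_sub_smul_pow_card (fun _ => wedge_sq _ _) (wedge_sq _ _) prod_erase_mul
    normSq_pos
  rw [Fintype.card_fin] at pow_card
  have pow_eq := (_root_.smul_pow Real.pi⁻¹ _ N).trans (congrArg (Real.pi⁻¹ ^ N • ·) pow_card)
  rw [evalForm_eq_topForm_map, map_pow, map_restrictCovector_extD_hopfConnection]
  refine (congrArg (topForm ℝ (N * 2))
    ((SubmonoidClass.coe_pow _ N).symm.trans (congrArg Subtype.val pow_eq))).trans ?_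
  rw [SetLike.val_smul, SetLike.val_smul, map_smul, map_smul, topForm_prod_wedge_pairBasis,
    smul_eq_mul, smul_eq_mul, mul_one, inv_pow]
  ring

end FubiniStudy

/-! ### Dirichlet integrals -/

section Dirichlet

open Set

theorem lintegral_ofReal_eq_of_integral_eq {α : Type*} [MeasurableSpace α] {μ : Measure α}
    {f : α → ℝ} {c : ℝ} (hf : 0 ≤ᵐ[μ] f) (hc : c ≠ 0) (h : ∫ x, f x ∂μ = c) :
    ∫⁻ x, ENNReal.ofReal (f x) ∂μ = ENNReal.ofReal c := by
  rw [← h, ofReal_integral_eq_lintegral_ofReal (.of_integral_ne_zero (h ▸ hc)) hf]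

theorem integral_pow_mul_exp_neg_mul_Ioi (n : ℕ) {r : ℝ} (hr : 0 < r) :
    ∫ t in Ioi (0 : ℝ), t ^ n * Real.exp (-(r * t)) = n.factorial / r ^ (n + 1) := by
  have h := Real.integral_rpow_mul_exp_neg_mul_Ioi (a := n + 1) (by positivity) hr
  rw [Real.Gamma_nat_eq_factorial, ← Nat.cast_succ, Real.rpow_natCast, one_div, inv_pow] at h
  rw [div_eq_inv_mul, ← h]
  simp only [Nat.cast_succ, add_sub_cancel_right, Real.rpow_natCast]

theorem integral_normSq_pow_mul_exp_neg (a : ℕ) {t : ℝ} (ht : 0 < t) :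
    ∫ u : ℂ, Complex.normSq u ^ a * Real.exp (-(t * Complex.normSq u)) =
      Real.pi * a.factorial / t ^ (a + 1) := by
  have h := Complex.integral_rpow_mul_exp_neg_mul_rpow (p := 2) (q := (2 * a : ℕ)) (b := t)
    one_le_two (by linarith [Nat.cast_nonneg (α := ℝ) (2 * a)]) ht
  have hexp : (((2 * a : ℕ) : ℝ) + 2) / 2 = (a + 1 : ℕ) := by push_cast; ring
  rw [hexp, neg_div, hexp, Real.rpow_neg ht.le, Real.rpow_natCast, Nat.cast_succ,
    Real.Gamma_nat_eq_factorial] at h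
  simp only [Real.rpow_natCast, Real.rpow_two, pow_mul, ← Complex.normSq_eq_norm_sq,
    neg_mul] at h
  rw [h]
  ring

theorem lintegral_prod_normSq_pow_mul_exp_neg {ι : Type*} [Fintype ι] (a : ι → ℕ) {t : ℝ}
    (ht : 0 < t) :
    ∫⁻ u : ι → ℂ, ENNReal.ofReal (∏ j, Complex.normSq (u j) ^ a j *
        Real.exp (-(t * Complex.normSq (u j)))) =
      ENNReal.ofReal (Real.pi ^ Fintype.card ι * (∏ j, ((a j).factorial : ℝ)) /
        t ^ (∑ j, a j + Fintype.card ι)) := by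
  refine lintegral_ofReal_eq_of_integral_eq (ae_of_all _ fun u => Finset.prod_nonneg fun j _ =>
    mul_nonneg (pow_nonneg (Complex.normSq_nonneg _) _) (Real.exp_pos _).le) ?_ ?_
  · have := Real.pi_pos
    positivity
  · rw [integral_fintype_prod_volume_eq_prod
      (f := fun j (v : ℂ) => Complex.normSq v ^ a j * Real.exp (-(t * Complex.normSq v)))]
    simp only [integral_normSq_pow_mul_exp_neg _ ht, Finset.prod_div_distrib,
      Finset.prod_mul_distrib, Finset.prod_const, Finset.card_univ, Finset.prod_pow_eq_pow_sum,
      Finset.sum_add_distrib, Finset.sum_const, smul_eq_mul, mul_one]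

/-- The integrand of a Dirichlet integral over `ℂ^ι`. The exponent of the denominator exceeds the
critical one by `c + 1`, so the integral converges for every `c : ℕ`. -/
def dirichletIntegrand {ι : Type*} [Fintype ι] (a : ι → ℕ) (c : ℕ) (u : ι → ℂ) : ℝ :=
  (∏ j, Complex.normSq (u j) ^ a j) /
    (1 + ∑ j, Complex.normSq (u j)) ^ (c + ∑ j, a j + Fintype.card ι + 1)

variable {ι : Type*} [Fintype ι] (a : ι → ℕ) (c : ℕ)

theorem dirichletIntegrand_nonneg (u : ι → ℂ) : 0 ≤ dirichletIntegrand a c u :=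
  div_nonneg (Finset.prod_nonneg fun _ _ => pow_nonneg (Complex.normSq_nonneg _) _)
    (pow_nonneg (add_nonneg zero_le_one
      (Finset.sum_nonneg fun _ _ => Complex.normSq_nonneg _)) _)

-- The power of the denominator is a Gamma integral in `t`; the integrand in `t` is then a product
-- of Gaussians in the `u j`.
theorem ofReal_dirichletIntegrand {m : ℕ} (hm : m = c + ∑ j, a j + Fintype.card ι)
    (u : ι → ℂ) :
    ENNReal.ofReal (dirichletIntegrand a c u) =
      ∫⁻ t in Ioi (0 : ℝ), ENNReal.ofReal (t ^ m * Real.exp (-t) / m.factorial) *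
        ENNReal.ofReal (∏ j, Complex.normSq (u j) ^ a j *
          Real.exp (-(t * Complex.normSq (u j)))) := by
  set S := 1 + ∑ j, Complex.normSq (u j) with hS
  have hS_pos : 0 < S :=
    add_pos_of_pos_of_nonneg one_pos (Finset.sum_nonneg fun _ _ => Complex.normSq_nonneg _)
  have hprod : 0 ≤ ∏ j, Complex.normSq (u j) ^ a j :=
    Finset.prod_nonneg fun j _ => pow_nonneg (Complex.normSq_nonneg _) _
  have hexp (t : ℝ) : Real.exp (-t) * ∏ j, Real.exp (-(t * Complex.normSq (u j))) =
      Real.exp (-(S * t)) := by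
    rw [← Real.exp_sum, ← Real.exp_add, hS, Finset.sum_neg_distrib, ← Finset.mul_sum]
    ring_nf
  have hgamma := lintegral_ofReal_eq_of_integral_eq
    (ae_restrict_of_forall_mem measurableSet_Ioi fun t (ht : 0 < t) => by
      simp only [Pi.zero_apply]; positivity) (by positivity)
    (integral_pow_mul_exp_neg_mul_Ioi m hS_pos)
  have hsplit : ENNReal.ofReal (dirichletIntegrand a c u) =
      ENNReal.ofReal ((∏ j, Complex.normSq (u j) ^ a j) / m.factorial) *
        ENNReal.ofReal (m.factorial / S ^ (m + 1)) := by
    rw [← ENNReal.ofReal_mul (by positivity), dirichletIntegrand, ← hm, ← hS]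
    field_simp
  rw [hsplit, ← hgamma, ← lintegral_const_mul' _ _ ENNReal.ofReal_ne_top]
  refine setLIntegral_congr_fun measurableSet_Ioi fun t (ht : 0 < t) => ?_
  rw [← ENNReal.ofReal_mul (by positivity), ← ENNReal.ofReal_mul (by positivity),
    Finset.prod_mul_distrib, ← hexp]
  congr 1
  ring

theorem lintegral_dirichletIntegrand :
    ∫⁻ u : ι → ℂ, ENNReal.ofReal (dirichletIntegrand a c u) =
      ENNReal.ofReal (Real.pi ^ Fintype.card ι * ((∏ j, ((a j).factorial : ℝ)) * c.factorial /
        (c + ∑ j, a j + Fintype.card ι).factorial)) := by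
  set m := c + ∑ j, a j + Fintype.card ι with hm
  have hnormSq : Measurable Complex.normSq := Complex.continuous_normSq.measurable
  have gaussian_factor (t : ℝ) (ht : t ∈ Ioi 0) :
      ∫⁻ u : ι → ℂ, ENNReal.ofReal (t ^ m * Real.exp (-t) / m.factorial) *
        ENNReal.ofReal (∏ j, Complex.normSq (u j) ^ a j *
          Real.exp (-(t * Complex.normSq (u j)))) =
      ENNReal.ofReal (Real.pi ^ Fintype.card ι * (∏ j, ((a j).factorial : ℝ)) / m.factorial) *
        ENNReal.ofReal (t ^ c * Real.exp (-(1 * t))) := by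
    have ht : 0 < t := ht
    rw [lintegral_const_mul' _ _ ENNReal.ofReal_ne_top,
      lintegral_prod_normSq_pow_mul_exp_neg a ht, ← ENNReal.ofReal_mul (by positivity),
      ← ENNReal.ofReal_mul (by have := Real.pi_pos; positivity), hm, add_assoc, pow_add, one_mul]
    congr 1
    field_simp
  simp only [ofReal_dirichletIntegrand a c hm]
  rw [lintegral_lintegral_swap (by fun_prop), setLIntegral_congr_fun measurableSet_Ioi
    gaussian_factor, lintegral_const_mul' _ _ ENNReal.ofReal_ne_top,
    lintegral_ofReal_eq_of_integral_eq (c := c.factorial) _ (by positivity)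
      (by simpa using integral_pow_mul_exp_neg_mul_Ioi c one_pos),
    ← ENNReal.ofReal_mul (by have := Real.pi_pos; positivity)]
  · congr 1
    ring
  · filter_upwards [ae_restrict_mem measurableSet_Ioi] with t ht
    have ht : 0 < t := ht
    positivity

theorem integrable_dirichletIntegrand : Integrable (dirichletIntegrand a c) := by
  have hnormSq : Measurable Complex.normSq := Complex.continuous_normSq.measurable
  refine ⟨Measurable.aestronglyMeasurable (by unfold dirichletIntegrand; fun_prop), ?_⟩
  rw [hasFiniteIntegral_iff_ofReal (ae_of_all _ (dirichletIntegrand_nonneg a c)),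
    lintegral_dirichletIntegrand]
  exact ENNReal.ofReal_lt_top

theorem integral_dirichletIntegrand :
    ∫ u : ι → ℂ, dirichletIntegrand a c u =
      Real.pi ^ Fintype.card ι * ((∏ j, ((a j).factorial : ℝ)) * c.factorial /
        (c + ∑ j, a j + Fintype.card ι).factorial) := by
  rw [integral_eq_lintegral_of_nonneg_ae (ae_of_all _ (dirichletIntegrand_nonneg a c))
    (integrable_dirichletIntegrand a c).1, lintegral_dirichletIntegrand,
    ENNReal.toReal_ofReal (by have := Real.pi_pos; positivity)]

end Dirichlet

/-! ### Residues at infinity -/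

section ResidueAtInfinity

variable {R : Type*} [CommRing R]

/-- The residue at infinity of `F / g` for monic `g`, that is, the coefficient of `X⁻¹` in its
expansion at infinity. The polynomial part of `F / g` does not contribute, so it is read off from
the remainder. -/
def resInfty (g : R[X]) : R[X] →ₗ[R] R :=
  (Polynomial.lcoeff R (g.natDegree - 1)).comp (Polynomial.modByMonicHom g)

theorem resInfty_apply (g F : R[X]) : resInfty g F = (F %ₘ g).coeff (g.natDegree - 1) :=
  rfl

theorem resInfty_of_degree_lt {g F : R[X]} (hg : g.Monic) (hF : F.degree < g.degree) :
    resInfty g F = F.coeff (g.natDegree - 1) := by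
  nontriviality R
  rw [resInfty_apply, (Polynomial.modByMonic_eq_self_iff hg).mpr hF]

theorem resInfty_eq_zero_of_dvd {g F : R[X]} (hg : g.Monic) (h : g ∣ F) : resInfty g F = 0 := by
  rw [resInfty_apply, (Polynomial.modByMonic_eq_zero_iff_dvd hg).mpr h, Polynomial.coeff_zero]

theorem resInfty_mul_mul {f g : R[X]} (hf : f.Monic) (hg : g.Monic) (F : R[X]) :
    resInfty (f * g) (f * F) = resInfty g F := by
  nontriviality R
  rcases eq_or_ne g 1 with rfl | hg1
  · rw [resInfty_eq_zero_of_dvd hg (one_dvd F),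
      resInfty_eq_zero_of_dvd (hf.mul hg) (by rw [mul_one]; exact dvd_mul_right f F)]
  have hlt := Polynomial.natDegree_modByMonic_lt F hg hg1
  have hrem : (f * F) %ₘ (f * g) = f * (F %ₘ g) := by
    refine (Polynomial.div_modByMonic_unique (F /ₘ g) _ (hf.mul hg) ⟨?_, ?_⟩).2
    · linear_combination f * Polynomial.modByMonic_add_div F g
    · rw [hf.degree_mul_comm, hf.degree_mul, hf.degree_mul_comm, hf.degree_mul]
      exact WithBot.add_lt_add_right (Polynomial.degree_ne_bot.mpr hf.ne_zero)
        (Polynomial.degree_modByMonic_lt F hg)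
  rw [resInfty_apply, resInfty_apply, hrem, hf.natDegree_mul hg, Nat.add_sub_assoc (by omega),
    Polynomial.coeff_mul_add_eq_of_natDegree_le le_rfl (by omega), hf.coeff_natDegree, one_mul]

theorem map_resInfty {S : Type*} [CommRing S] (f : R →+* S) {g : R[X]} (hg : g.Monic)
    (F : R[X]) : f (resInfty g F) = resInfty (g.map f) (F.map f) := by
  nontriviality S
  rw [resInfty_apply, resInfty_apply, ← Polynomial.map_modByMonic f hg, hg.natDegree_map,
    Polynomial.coeff_map]

theorem mk_pow_mul_one_sub (c : R) :
    PowerSeries.mk (c ^ ·) * (1 - PowerSeries.C c * PowerSeries.X) = 1 := by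
  ext n
  rw [mul_sub, mul_one, ← mul_assoc, map_sub, PowerSeries.coeff_one, PowerSeries.coeff_mk]
  cases n with
  | zero => rw [PowerSeries.coeff_zero_mul_X, pow_zero, sub_zero, if_pos rfl]
  | succ n =>
    rw [PowerSeries.coeff_succ_mul_X, PowerSeries.coeff_mul_C, PowerSeries.coeff_mk, pow_succ,
      sub_self, if_neg n.succ_ne_zero]

theorem mk_resInfty_X_sub_C_mul (c : R) {g : R[X]} (hg : g.Monic) (hdeg : 0 < g.natDegree) :
    PowerSeries.mk (fun n => resInfty ((Polynomial.X - Polynomial.C c) * g) (Polynomial.X ^ n)) *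
        (1 - PowerSeries.C c * PowerSeries.X) =
      PowerSeries.X * PowerSeries.mk fun n => resInfty g (Polynomial.X ^ n) := by
  nontriviality R
  have hmonic : ((Polynomial.X - Polynomial.C c) * g).Monic := (Polynomial.monic_X_sub_C c).mul hg
  have hnatDegree : ((Polynomial.X - Polynomial.C c) * g).natDegree = 1 + g.natDegree := by
    rw [(Polynomial.monic_X_sub_C c).natDegree_mul hg, Polynomial.natDegree_X_sub_C]
  ext n
  rw [mul_sub, mul_one, ← mul_assoc, map_sub]
  cases n with
  | zero =>
    rw [PowerSeries.coeff_zero_mul_X, PowerSeries.coeff_zero_X_mul, PowerSeries.coeff_mk, sub_zero,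
      pow_zero, resInfty_of_degree_lt hmonic, hnatDegree, Polynomial.coeff_one,
      if_neg (by omega)]
    rw [Polynomial.degree_one, Polynomial.degree_eq_natDegree hmonic.ne_zero, hnatDegree]
    exact_mod_cast Nat.add_pos_left one_pos _
  | succ n =>
    rw [PowerSeries.coeff_succ_mul_X, PowerSeries.coeff_succ_X_mul, PowerSeries.coeff_mul_C,
      PowerSeries.coeff_mk, PowerSeries.coeff_mk, PowerSeries.coeff_mk,
      ← resInfty_mul_mul (Polynomial.monic_X_sub_C c) hg,
      sub_mul Polynomial.X (Polynomial.C c) (Polynomial.X ^ n), ← pow_succ',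
      ← Polynomial.smul_eq_C_mul, map_sub, map_smul, smul_eq_mul, mul_comm _ c]

theorem mk_resInfty_X_pow {ι : Type*} {s : Finset ι} (hs : s.Nonempty) (c : ι → R) :
    PowerSeries.mk (fun n =>
        resInfty (∏ j ∈ s, (Polynomial.X - Polynomial.C (c j))) (Polynomial.X ^ n)) =
      PowerSeries.X ^ (s.card - 1) * ∏ j ∈ s, PowerSeries.mk (c j ^ ·) := by
  nontriviality R
  induction hs using Finset.Nonempty.cons_induction with
  | singleton j =>
    ext n
    simp only [Finset.prod_singleton, Finset.card_singleton, tsub_self, pow_zero, one_mul,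
      PowerSeries.coeff_mk, resInfty_apply, Polynomial.modByMonic_X_sub_C_eq_C_eval,
      Polynomial.eval_pow, Polynomial.eval_X, Polynomial.natDegree_X_sub_C,
      Polynomial.coeff_C_zero]
  | cons j s hj hs ih =>
    have hcard := hs.card_pos
    have hstep := mk_resInfty_X_sub_C_mul (c j) (Polynomial.monic_prod_X_sub_C c s)
      (by rwa [Polynomial.natDegree_finsetProd_X_sub_C_eq_card])
    rw [Finset.prod_cons, Finset.prod_cons, Finset.card_cons, Nat.add_sub_cancel,
      ← Nat.sub_add_cancel hcard, pow_succ']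
    rw [ih] at hstep
    linear_combination PowerSeries.mk (c j ^ ·) * hstep - PowerSeries.mk (fun n =>
      resInfty ((Polynomial.X - Polynomial.C (c j)) * ∏ j ∈ s,
        (Polynomial.X - Polynomial.C (c j))) (Polynomial.X ^ n)) * mk_pow_mul_one_sub (c j)

theorem resInfty_prod_X_sub_C_X_pow {ι : Type*} [DecidableEq ι] {s : Finset ι} (hs : s.Nonempty)
    (c : ι → R) (n : ℕ) :
    resInfty (∏ j ∈ s, (Polynomial.X - Polynomial.C (c j))) (Polynomial.X ^ n) =
      if s.card - 1 ≤ n then ∑ a ∈ s.piAntidiag (n - (s.card - 1)), ∏ j ∈ s, c j ^ a j else 0 := by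
  have h := congrArg (PowerSeries.coeff n) (mk_resInfty_X_pow hs c)
  rw [PowerSeries.coeff_mk, PowerSeries.coeff_X_pow_mul'] at h
  rw [h]
  congr 1
  rw [PowerSeries.coeff_prod]
  refine Finset.sum_bij (fun l _ => ⇑l) (fun l hl => ?_) (fun _ _ _ _ h => DFunLike.coe_injective h)
    (fun a ha => ?_) fun l _ => ?_
  · simpa [Finset.mem_finsuppAntidiag, Finset.subset_iff] using hl
  · obtain ⟨hsum, hsupp⟩ := Finset.mem_piAntidiag.mp ha
    exact ⟨Finsupp.onFinset s a hsupp,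
      Finset.mem_finsuppAntidiag.mpr ⟨hsum, Finsupp.support_onFinset_subset⟩, rfl⟩
  · simp only [PowerSeries.coeff_mk]

/-- The residue theorem: `u i` is an inverse modulo `g i` of the product of the other factors. -/
theorem resInfty_prod {ι : Type*} [DecidableEq ι] (s : Finset ι) {g u : ι → R[X]}
    (hg : ∀ i ∈ s, (g i).Monic) (hu : ∀ i ∈ s, g i ∣ 1 - u i * ∏ j ∈ s.erase i, g j) (F : R[X]) :
    resInfty (∏ i ∈ s, g i) F = ∑ i ∈ s, resInfty (g i) (F * u i) := by
  have hres (i) (hi : i ∈ s) : resInfty (g i) (F * u i) =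
      resInfty (∏ i ∈ s, g i) ((∏ j ∈ s.erase i, g j) * (F * u i)) := by
    rw [← Finset.prod_erase_mul s g hi, resInfty_mul_mul
      (Polynomial.monic_prod_of_monic _ _ fun j hj => hg j (Finset.mem_of_mem_erase hj)) (hg i hi)]
  have hcoprime : (s : Set ι).Pairwise (Function.onFun IsCoprime g) := fun i hi j hj hij => by
    obtain ⟨v, hv⟩ := hu i hi
    refine IsCoprime.of_isCoprime_of_dvd_right ⟨v, u i, ?_⟩
      (Finset.dvd_prod_of_mem g (Finset.mem_erase.mpr ⟨hij.symm, hj⟩))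
    linear_combination -hv
  rw [Finset.sum_congr rfl hres, ← map_sum, ← sub_eq_zero, ← map_sub]
  refine resInfty_eq_zero_of_dvd (Polynomial.monic_prod_of_monic _ _ hg)
    (Finset.prod_dvd_of_coprime hcoprime fun i hi => ?_)
  rw [← Finset.add_sum_erase s _ hi, ← sub_sub]
  refine dvd_sub ?_ (Finset.dvd_sum fun j hj => ?_)
  · convert (hu i hi).mul_left F using 1
    ring
  · exact (Finset.dvd_prod_of_mem g (Finset.mem_erase.mpr
      ⟨(Finset.ne_of_mem_erase hj).symm, hi⟩)).mul_right _

end ResidueAtInfinity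

/-! ### Equivariant integration over projective space -/

section EquivariantIntegral

variable {N : ℕ}

/-- The moment map of the linear circle action with weights `w`, in the affine chart. -/
def momentMap (w : Fin (N + 1) → ℝ) (u : Fin N → ℂ) : ℝ :=
  (∑ j, w j * Complex.normSq (chart u j)) / (1 + ∑ j, Complex.normSq (u j))

/-- The density of the `N`-th power of the Fubini–Study form in the affine chart; its total mass
is `1`. -/
def fubiniStudyDensity (u : Fin N → ℂ) : ℝ :=
  N.factorial / Real.pi ^ N / (1 + ∑ j, Complex.normSq (u j)) ^ (N + 1)

theorem momentMap_pow_mul_fubiniStudyDensity (w : Fin (N + 1) → ℝ) (m : ℕ) (u : Fin N → ℂ) :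
    momentMap w u ^ m * fubiniStudyDensity u = ∑ a ∈ Finset.piAntidiag Finset.univ m,
      Nat.multinomial Finset.univ a * (∏ j, w j ^ a j) * (N.factorial / Real.pi ^ N) *
        dirichletIntegrand (fun j : Fin N => a j.succ) (a 0) u := by
  rw [momentMap, fubiniStudyDensity, div_pow, Finset.sum_pow_eq_sum_piAntidiag, Finset.sum_div,
    Finset.sum_mul]
  refine Finset.sum_congr rfl fun a ha => ?_
  have hdegree : a 0 + ∑ j : Fin N, a j.succ = m := by
    rw [← Fin.sum_univ_succ]; exact (Finset.mem_piAntidiag.mp ha).1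
  have hprod : ∏ j, Complex.normSq (chart u j) ^ a j =
      ∏ j : Fin N, Complex.normSq (u j) ^ a j.succ := by
    simp [Fin.prod_univ_succ, chart]
  have hnormSq : 1 + ∑ j, Complex.normSq (u j) ≠ 0 :=
    (sum_normSq_chart u ▸ sum_normSq_chart_pos u).ne'
  simp only [mul_pow, Finset.prod_mul_distrib]
  rw [dirichletIntegrand, hdegree, hprod, Fintype.card_fin, add_assoc m, pow_add _ m]
  field_simp

theorem integrable_momentMap_pow_mul_fubiniStudyDensity (w : Fin (N + 1) → ℝ) (m : ℕ) :
    Integrable fun u => momentMap w u ^ m * fubiniStudyDensity u := by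
  simp only [momentMap_pow_mul_fubiniStudyDensity]
  exact integrable_finsetSum _ fun a _ => (integrable_dirichletIntegrand _ _).const_mul _

theorem choose_mul_integral_momentMap_pow (w : Fin (N + 1) → ℝ) (m : ℕ) :
    ((m + N).choose N : ℝ) * ∫ u, momentMap w u ^ m * fubiniStudyDensity u =
      ∑ a ∈ Finset.piAntidiag Finset.univ m, ∏ j, w j ^ a j := by
  simp only [momentMap_pow_mul_fubiniStudyDensity]
  rw [integral_finsetSum _ fun a _ => (integrable_dirichletIntegrand _ _).const_mul _,
    Finset.mul_sum]
  refine Finset.sum_congr rfl fun a ha => ?_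
  have hdegree : ∑ j, a j = m := (Finset.mem_piAntidiag.mp ha).1
  have hmultinomial : (∏ j, ((a j).factorial : ℝ)) * Nat.multinomial Finset.univ a =
      m.factorial := by
    rw [← hdegree]
    exact_mod_cast Nat.multinomial_spec Finset.univ a
  have hchoose : ((m + N).choose N : ℝ) * m.factorial * N.factorial = (m + N).factorial := by
    exact_mod_cast Nat.add_choose_mul_factorial_mul_factorial m N
  rw [Fin.prod_univ_succ] at hmultinomial
  rw [Fin.sum_univ_succ] at hdegree
  rw [integral_const_mul, integral_dirichletIntegrand, hdegree, Fintype.card_fin]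
  field_simp
  rw [← hchoose, ← hmultinomial]
  ring

theorem generator_apply (w : Fin (N + 1) → ℕ) (x : HomCoord N) (j : Fin (N + 1)) :
    generator w x j = Complex.I * w j * x j := by
  have hasDerivAt_rotate :
      HasDerivAt (fun t : ℝ => rotate w t x) (fun j => Complex.I * w j * x j) 0 := by
    refine hasDerivAt_pi.mpr fun j => ?_
    have hexponent : HasDerivAt (fun t : ℝ => Complex.I * (t : ℂ) * (w j : ℂ))
        (Complex.I * 1 * w j) 0 :=
      ((Complex.ofRealCLM.hasDerivAt (x := (0 : ℝ))).const_mul Complex.I).mul_const _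
    refine (hexponent.cexp.mul_const (x j)).congr_deriv ?_
    simp only [Complex.ofReal_zero, mul_zero, zero_mul, Complex.exp_zero, mul_one, one_mul]
  rw [generator, hasDerivAt_rotate.deriv]

theorem two_pi_mul_hopfConnection_generator (w : Fin (N + 1) → ℕ) (u : Fin N → ℂ) :
    2 * Real.pi * hopfConnection (chart u) (generator w (chart u)) =
      momentMap (fun j => (w j : ℝ)) u := by
  have hnormSq : 1 + ∑ j, Complex.normSq (u j) ≠ 0 :=
    (sum_normSq_chart u ▸ sum_normSq_chart_pos u).ne'
  have hgenerator (j : Fin (N + 1)) :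
      (chart u j).re * (generator w (chart u) j).im -
          (chart u j).im * (generator w (chart u) j).re =
        w j * Complex.normSq (chart u j) := by
    simp only [generator_apply, Complex.mul_im, Complex.mul_re, Complex.I_re, Complex.natCast_re,
      zero_mul, Complex.I_im, Complex.natCast_im, mul_zero, sub_self, one_mul, zero_add, zero_sub,
      mul_neg, sub_neg_eq_add, Complex.normSq_apply]
    ring
  rw [hopfConnection, momentMap, _root_.smul_apply, _root_.sum_apply, sum_normSq_chart,
    smul_eq_mul]
  simp only [_root_.sub_apply, _root_.smul_apply, dRe_apply, dIm_apply, smul_eq_mul, hgenerator]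
  field_simp

/-- The density in the affine chart of the coefficient of `ħ^l` of an equivariant form. -/
def chartDensity (α : EquivForm N) (l : ℕ) (u : Fin N → ℂ) : ℝ :=
  evalForm (chartFrame N) (α.coeff l (chart u))

/-- Convergence of the integral of an equivariant form over the affine chart. -/
def IntegrableForm (α : EquivForm N) : Prop :=
  ∀ l, Integrable (chartDensity α l)

theorem coeff_equivIntegral (α : EquivForm N) (l : ℕ) :
    (equivIntegral α).coeff l = ∫ u, chartDensity α l u := by
  rw [equivIntegral, Polynomial.sum, Polynomial.finsetSum_coeff]
  simp only [Polynomial.coeff_monomial, chartDensity]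
  rw [Finset.sum_ite_eq']
  split_ifs with h
  · rfl
  · rw [Polynomial.notMem_support_iff.mp h]
    simp only [Pi.zero_apply, map_zero, integral_zero]

theorem chartDensity_add (α β : EquivForm N) (l : ℕ) (u : Fin N → ℂ) :
    chartDensity (α + β) l u = chartDensity α l u + chartDensity β l u := by
  rw [chartDensity, Polynomial.coeff_add, Pi.add_apply, map_add, chartDensity, chartDensity]

theorem IntegrableForm.add {α β : EquivForm N} (hα : IntegrableForm α) (hβ : IntegrableForm β) :
    IntegrableForm (α + β) := fun l =>
  ((hα l).add (hβ l)).congr (.of_forall fun u => (chartDensity_add α β l u).symm)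

theorem equivIntegral_add {α β : EquivForm N} (hα : IntegrableForm α) (hβ : IntegrableForm β) :
    equivIntegral (α + β) = equivIntegral α + equivIntegral β := by
  ext l
  simp only [Polynomial.coeff_add, coeff_equivIntegral, chartDensity_add]
  exact integral_add (hα l) (hβ l)

theorem chartDensity_map_mul (f : ℝ[X]) (α : EquivForm N) (l : ℕ) (u : Fin N → ℂ) :
    chartDensity (f.map (algebraMap ℝ (HomCoord N → Form N)) * α) l u =
      ∑ i ∈ Finset.HasAntidiagonal.antidiagonal l, f.coeff i.1 * chartDensity α i.2 u := by
  simp only [chartDensity, Polynomial.coeff_mul, Polynomial.coeff_map, ← Algebra.smul_def,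
    Finset.sum_apply, Pi.smul_apply, map_sum, map_smul, smul_eq_mul]

theorem IntegrableForm.map_mul {α : EquivForm N} (hα : IntegrableForm α) (f : ℝ[X]) :
    IntegrableForm (f.map (algebraMap ℝ (HomCoord N → Form N)) * α) := fun l =>
  (integrable_finsetSum _ fun i _ => (hα i.2).const_mul (f.coeff i.1)).congr
    (.of_forall fun u => (chartDensity_map_mul f α l u).symm)

theorem equivIntegral_map_mul {α : EquivForm N} (hα : IntegrableForm α) (f : ℝ[X]) :
    equivIntegral (f.map (algebraMap ℝ (HomCoord N → Form N)) * α) = f * equivIntegral α := by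
  ext l
  simp only [Polynomial.coeff_mul, coeff_equivIntegral, chartDensity_map_mul]
  rw [integral_finsetSum _ fun i _ => (hα i.2).const_mul _]
  simp only [integral_const_mul]

theorem coeff_C_add_C_mul_X_pow {A : Type*} [Semiring A] {a b : A} (hab : Commute a b) (n l : ℕ) :
    ((Polynomial.C a + Polynomial.C b * Polynomial.X) ^ n).coeff l =
      n.choose l • (b ^ l * a ^ (n - l)) := by
  have commute_C : Commute (Polynomial.C b * Polynomial.X) (Polynomial.C a) :=
    (hab.symm.map Polynomial.C).mul_left (Polynomial.commute_X _)
  have monomial_pow (k : ℕ) :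
      (Polynomial.C b * Polynomial.X) ^ k * Polynomial.C a ^ (n - k) * (n.choose k : A[X]) =
        Polynomial.monomial k (n.choose k • (b ^ k * a ^ (n - k))) := by
    rw [Polynomial.C_mul_X_eq_monomial, Polynomial.monomial_pow, one_mul, ← Polynomial.C_pow,
      Polynomial.monomial_mul_C, ← Polynomial.C_eq_natCast, Polynomial.monomial_mul_C,
      ← Nat.cast_comm, nsmul_eq_mul]
  rw [add_comm, commute_C.add_pow, Polynomial.finsetSum_coeff]
  simp only [monomial_pow, Polynomial.coeff_monomial]
  rw [Finset.sum_ite_eq', ite_eq_left_iff]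
  intro hl
  rw [Nat.choose_eq_zero_of_lt (by simpa using hl), zero_smul]

theorem chartDensity_pForm_pow (w : Fin (N + 1) → ℕ) (n l : ℕ) (u : Fin N → ℂ) :
    chartDensity (pForm w ^ n) l u =
      if l + N = n then
        n.choose N * (momentMap (fun j => (w j : ℝ)) u ^ l * fubiniStudyDensity u)
      else 0 := by
  have commute_moment : Commute (extD hopfConnection) fun x : HomCoord N =>
      algebraMap ℝ (Form N) (2 * Real.pi * hopfConnection x (generator w x)) := by
    ext1 x
    exact (Algebra.commutes _ _).symm
  have density_eq : chartDensity (pForm w ^ n) l u =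
      n.choose l * (momentMap (fun j => (w j : ℝ)) u ^ l *
        evalForm (chartFrame N) (extD hopfConnection (chart u) ^ (n - l))) := by
    rw [chartDensity, pForm, hbarForm, coeff_C_add_C_mul_X_pow commute_moment, Pi.smul_apply,
      Pi.mul_apply, Pi.pow_apply, Pi.pow_apply, two_pi_mul_hopfConnection_generator, map_nsmul,
      ← map_pow, ← Algebra.smul_def, map_smul, nsmul_eq_mul, smul_eq_mul]
  rw [density_eq]
  split_ifs with hl
  · rw [← hl, Nat.add_sub_cancel_left, evalForm_extD_hopfConnection_pow, Nat.choose_symm_add,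
      fubiniStudyDensity]
  · obtain hnl | hln := lt_or_ge n l
    · rw [Nat.choose_eq_zero_of_lt hnl, Nat.cast_zero, zero_mul]
    · rw [evalForm_extD_pow_eq_zero _ (by omega), mul_zero, mul_zero]

theorem integrableForm_pForm_pow (w : Fin (N + 1) → ℕ) (n : ℕ) :
    IntegrableForm (pForm w ^ n) := fun l => by
  change Integrable fun u => chartDensity (pForm w ^ n) l u
  simp only [chartDensity_pForm_pow]
  split_ifs
  · exact (integrable_momentMap_pow_mul_fubiniStudyDensity _ l).const_mul _
  · exact integrable_zero _ _ _

/-- The denominator `∏ (p - w_j ħ)` of the integration formula, a polynomial in `p` over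
`ℝ[ħ]`. -/
def weightPoly (w : Fin (N + 1) → ℕ) : ℝ[X][X] :=
  ∏ j, (Polynomial.X - Polynomial.C (Polynomial.C (w j : ℝ) * Polynomial.X))

theorem equivIntegral_pForm_pow (w : Fin (N + 1) → ℕ) (n : ℕ) :
    equivIntegral (pForm w ^ n) = resInfty (weightPoly w) (Polynomial.X ^ n) := by
  have monomial_eq (a : Fin (N + 1) → ℕ) (m : ℕ) (ha : a ∈ Finset.piAntidiag Finset.univ m) :
      ∏ j, (Polynomial.C (w j : ℝ) * Polynomial.X) ^ a j =
        Polynomial.monomial m (∏ j, (w j : ℝ) ^ a j) := by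
    simp only [mul_pow, Finset.prod_mul_distrib, Finset.prod_pow_eq_pow_sum, ← map_pow, ← map_prod]
    rw [(Finset.mem_piAntidiag.mp ha).1, Polynomial.C_mul_X_pow_eq_monomial]
  ext l
  rw [weightPoly, resInfty_prod_X_sub_C_X_pow Finset.univ_nonempty, Finset.card_univ,
    Fintype.card_fin, Nat.add_sub_cancel, coeff_equivIntegral]
  simp only [chartDensity_pForm_pow]
  obtain hnN | ⟨m, rfl⟩ := (lt_or_ge n N).imp_right Nat.exists_eq_add_of_le'
  · have hl : l + N ≠ n := by omega
    simp only [if_neg hnN.not_ge, if_neg hl, integral_zero, Polynomial.coeff_zero]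
  · rw [if_pos (Nat.le_add_left N m), Nat.add_sub_cancel, Finset.sum_congr rfl (monomial_eq · m),
      ← map_sum, Polynomial.coeff_monomial, ← choose_mul_integral_momentMap_pow]
    by_cases hl : l = m
    · subst hl
      simp only [if_true, integral_const_mul]
    · simp only [add_left_inj, if_neg hl, if_neg (Ne.symm hl), integral_zero]

theorem commute_map_algebraMap (f : ℝ[X]) (α : EquivForm N) :
    Commute (Polynomial.mapRingHom (algebraMap ℝ (HomCoord N → Form N)) f) α := by
  induction f using Polynomial.induction_on' with
  | add p q hp hq => rw [map_add]; exact hp.add_left hq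
  | monomial n c =>
    rw [Polynomial.coe_mapRingHom, Polynomial.map_monomial, ← Polynomial.C_mul_X_pow_eq_monomial]
    have commute_C : Commute (algebraMap ℝ (EquivForm N) c) α := Algebra.commutes c α
    exact commute_C.mul_left (Polynomial.commute_X_pow α n)

/-- Substitution of the class `p` into a polynomial with coefficients in `H^*(BS¹) = ℝ[ħ]`. -/
def evalP (w : Fin (N + 1) → ℕ) : ℝ[X][X] →+* EquivForm N :=
  Polynomial.eval₂RingHom' (Polynomial.mapRingHom (algebraMap ℝ (HomCoord N → Form N)))
    (pForm w) fun f => commute_map_algebraMap f _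

theorem evalP_X (w : Fin (N + 1) → ℕ) : evalP w Polynomial.X = pForm w :=
  Polynomial.eval₂_X _ _

theorem evalP_C (w : Fin (N + 1) → ℕ) (f : ℝ[X]) :
    evalP w (Polynomial.C f) = f.map (algebraMap ℝ (HomCoord N → Form N)) :=
  Polynomial.eval₂_C _ _

theorem integrableForm_evalP (w : Fin (N + 1) → ℕ) (F : ℝ[X][X]) : IntegrableForm (evalP w F) := by
  induction F using Polynomial.induction_on' with
  | add F G hF hG => rw [map_add]; exact hF.add hG
  | monomial n f =>
    rw [← Polynomial.C_mul_X_pow_eq_monomial, map_mul, map_pow, evalP_X, evalP_C]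
    exact (integrableForm_pForm_pow w n).map_mul f

theorem equivIntegral_evalP (w : Fin (N + 1) → ℕ) (F : ℝ[X][X]) :
    equivIntegral (evalP w F) = resInfty (weightPoly w) F := by
  induction F using Polynomial.induction_on' with
  | add F G hF hG =>
    rw [map_add, equivIntegral_add (integrableForm_evalP w F) (integrableForm_evalP w G), hF, hG,
      map_add]
  | monomial n f =>
    rw [← Polynomial.C_mul_X_pow_eq_monomial, map_mul, map_pow, evalP_X, evalP_C,
      equivIntegral_map_mul (integrableForm_pForm_pow w n), equivIntegral_pForm_pow,
      ← Polynomial.smul_eq_C_mul, map_smul, smul_eq_mul]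

end EquivariantIntegral

/-! ### The hypergeometric differential equation -/

section QuinticAlgebra

variable {K : Type*} [Field K]

theorem clsP_pow_four : clsP K ^ 4 = 0 := by
  rw [clsP, ← AdjoinRoot.mk_X, ← map_pow, AdjoinRoot.mk_self]

theorem comp_mk {j : ℕ} (hj : j < 4) (g : K[X]) :
    comp j (AdjoinRoot.mk (Polynomial.X ^ 4 : K[X]) g) = g.coeff j := by
  rw [comp, LinearMap.comp_apply, AdjoinRoot.modByMonicHom_mk, Polynomial.lcoeff_apply]
  conv_rhs => rw [← Polynomial.modByMonic_add_div g (Polynomial.X ^ 4 : K[X])]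
  rw [Polynomial.coeff_add, Polynomial.coeff_X_pow_mul', if_neg hj.not_ge, add_zero]

theorem comp_algebraMap_mul_clsP_pow {j : ℕ} (hj : j < 4) (c : K) (i : ℕ) :
    comp j (algebraMap K (QuinticAlg K) c * clsP K ^ i) = if j = i then c else 0 := by
  have mk_eq : algebraMap K (QuinticAlg K) c * clsP K ^ i =
      AdjoinRoot.mk (Polynomial.X ^ 4 : K[X]) (Polynomial.C c * Polynomial.X ^ i) := by
    rw [map_mul, map_pow, AdjoinRoot.mk_X, AdjoinRoot.mk_C]
    rfl
  rw [mk_eq, comp_mk hj, Polynomial.coeff_C_mul_X_pow]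

theorem isNilpotent_clsP : IsNilpotent (clsP K) :=
  ⟨4, clsP_pow_four⟩

theorem isUnit_clsP_add {c : K} (hc : c ≠ 0) :
    IsUnit (clsP K + algebraMap K (QuinticAlg K) c) :=
  isNilpotent_clsP.isUnit_add_right_of_commute ((IsUnit.mk0 c hc).map _) (Commute.all _ _)

theorem coeff_polyMap (f : QuinticAlg K →ₗ[K] K) (g : (QuinticAlg K)[X]) (n : ℕ) :
    (polyMap f g).coeff n = f (g.coeff n) := by
  rw [polyMap, Polynomial.sum, Polynomial.finsetSum_coeff]
  simp only [Polynomial.coeff_monomial]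
  rw [Finset.sum_ite_eq', ite_eq_left_iff, Polynomial.notMem_support_iff]
  exact fun h => by rw [h, map_zero]

/-- `polyMap f` as a linear map. -/
def polyMapₗ (f : QuinticAlg K →ₗ[K] K) : (QuinticAlg K)[X] →ₗ[K] K[X] where
  toFun := polyMap f
  map_add' a b := by ext n; simp only [coeff_polyMap, Polynomial.coeff_add, map_add]
  map_smul' a b := by ext n; simp only [coeff_polyMap, Polynomial.coeff_smul, map_smul,
    RingHom.id_apply]

theorem derivative_polyMap (f : QuinticAlg K →ₗ[K] K) (g : (QuinticAlg K)[X]) :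
    derivative (polyMap f g) = polyMap f (derivative g) := by
  ext n
  rw [coeff_polyMap, Polynomial.coeff_derivative, Polynomial.coeff_derivative, coeff_polyMap,
    ← Nat.cast_succ, ← Nat.cast_succ, ← nsmul_eq_mul', ← nsmul_eq_mul', map_nsmul]

theorem coeff_expLog (h : K) (n : ℕ) :
    (expLog h).coeff n =
      algebraMap K (QuinticAlg K) ((n.factorial : K)⁻¹ * h⁻¹ ^ n) * clsP K ^ n := by
  rw [expLog, Polynomial.finsetSum_coeff]
  simp only [Polynomial.coeff_monomial]
  rw [Finset.sum_ite_eq', ite_eq_left_iff, Finset.mem_range, not_lt]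
  intro hn
  rw [pow_eq_zero_of_le hn clsP_pow_four, mul_zero]

theorem derivative_expLog [CharZero K] (h : K) :
    derivative (expLog h) = Polynomial.C (h⁻¹ • clsP K) * expLog h := by
  ext n
  have inv_factorial_succ : ((n + 1).factorial : K)⁻¹ * h⁻¹ ^ (n + 1) * (n + 1 : ℕ) =
      h⁻¹ * ((n.factorial : K)⁻¹ * h⁻¹ ^ n) := by
    have hn : ((n + 1 : ℕ) : K) ≠ 0 := Nat.cast_ne_zero.mpr n.succ_ne_zero
    rw [Nat.factorial_succ, Nat.cast_mul, mul_inv, pow_succ']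
    field_simp
  rw [Polynomial.coeff_derivative, Polynomial.coeff_C_mul, coeff_expLog, coeff_expLog,
    ← Nat.cast_succ, ← map_natCast (algebraMap K (QuinticAlg K)), mul_right_comm, ← map_mul,
    inv_factorial_succ, map_mul, Algebra.smul_def]
  ring

end QuinticAlgebra

theorem map_aeval_apply_of_forall {R M N : Type*} [CommSemiring R] [AddCommMonoid M]
    [AddCommMonoid N] [Module R M] [Module R N] (g : M →ₗ[R] N) {S : Module.End R M}
    {T : Module.End R N} (hST : ∀ x, g (S x) = T (g x)) (p : R[X]) (x : M) :
    g (Polynomial.aeval S p x) = Polynomial.aeval T p (g x) := by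
  induction p using Polynomial.induction_on' with
  | add p q hp hq => simp only [map_add, LinearMap.add_apply, hp, hq]
  | monomial n c =>
    have hpow : g ((S ^ n) x) = (T ^ n) (g x) := by
      rw [Module.End.pow_apply, Module.End.pow_apply]
      exact Function.Semiconj.iterate_right hST n x
    simp only [Polynomial.aeval_monomial, Module.End.mul_apply, Module.algebraMap_end_apply,
      map_smul, hpow]

section DifferentialEquation

variable {K : Type*} [Field K]

/-- The polynomial `5 (5D + 1) (5D + 2) (5D + 3) (5D + 4)`; with `D = q d/dq`, the right-hand side
of the differential equation is `q` times this operator. -/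
def picardFuchsPoly (K : Type*) [Field K] : K[X] :=
  5 * ((5 * Polynomial.X + 1) * (5 * Polynomial.X + 2) * (5 * Polynomial.X + 3) *
    (5 * Polynomial.X + 4))

/-- The operator `d + d/dℓ`: the action of `q d/dq` on the coefficient of `q^d`. -/
def shiftDeriv (K : Type*) [Field K] (d : ℕ) : Module.End K K[X] :=
  (d : K) • 1 + Polynomial.derivative

theorem coeff_qDeriv (f : K[X]⟦X⟧) (d : ℕ) :
    PowerSeries.coeff d (qDeriv K f) = shiftDeriv K d (PowerSeries.coeff d f) := by
  simp [qDeriv, shiftDeriv]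

theorem coeff_aeval_qDeriv (p : K[X]) (f : K[X]⟦X⟧) (d : ℕ) :
    PowerSeries.coeff d (Polynomial.aeval (qDeriv K) p f) =
      Polynomial.aeval (shiftDeriv K d) p (PowerSeries.coeff d f) :=
  map_aeval_apply_of_forall ((PowerSeries.coeff (R := K[X]) d).restrictScalars K)
    (coeff_qDeriv · d) p f

theorem mem_solutionSpace_iff (f : K[X]⟦X⟧) :
    f ∈ solutionSpace K ↔ (shiftDeriv K 0 ^ 4) (PowerSeries.coeff 0 f) = 0 ∧
      ∀ d, (shiftDeriv K (d + 1) ^ 4) (PowerSeries.coeff (d + 1) f) =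
        Polynomial.aeval (shiftDeriv K d) (picardFuchsPoly K) (PowerSeries.coeff d f) := by
  have operator_eq : 5 * mulQ K * (5 * qDeriv K + 1) * (5 * qDeriv K + 2) * (5 * qDeriv K + 3) *
      (5 * qDeriv K + 4) = mulQ K * Polynomial.aeval (qDeriv K) (picardFuchsPoly K) := by
    simp only [picardFuchsPoly, map_mul, map_add, map_ofNat, map_one, Polynomial.aeval_X,
      mul_assoc, (Commute.ofNat_left 5 (mulQ K)).left_comm]
  have coeff_qDeriv_pow (d : ℕ) : PowerSeries.coeff d ((qDeriv K ^ 4) f) =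
      (shiftDeriv K d ^ 4) (PowerSeries.coeff d f) := by
    have := coeff_aeval_qDeriv (Polynomial.X ^ 4) f d
    rwa [map_pow, map_pow, Polynomial.aeval_X, Polynomial.aeval_X] at this
  rw [solutionSpace, operator_eq, LinearMap.mem_ker, LinearMap.sub_apply, sub_eq_zero,
    PowerSeries.ext_iff, ← Nat.and_forall_add_one]
  simp only [Module.End.mul_apply, mulQ, LinearMap.mulLeft_apply, coeff_qDeriv_pow,
    coeff_aeval_qDeriv, PowerSeries.coeff_zero_X_mul, PowerSeries.coeff_succ_X_mul]

theorem shiftDeriv_injective [CharZero K] {d : ℕ} (hd : d ≠ 0) :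
    Function.Injective (shiftDeriv K d) := by
  rw [injective_iff_map_eq_zero]
  intro g hg
  by_contra hne
  have hsmul : (d : K) • g = -derivative g := eq_neg_of_add_eq_zero_left hg
  have degree_lt := Polynomial.degree_derivative_lt hne
  rw [← Polynomial.degree_neg, ← hsmul, Polynomial.degree_smul_of_smul_regular _
    (IsSMulRegular.of_ne_zero (Nat.cast_ne_zero.mpr hd))] at degree_lt
  exact lt_irrefl _ degree_lt

theorem eq_zero_of_mem_solutionSpace [CharZero K] {f : K[X]⟦X⟧} (hf : f ∈ solutionSpace K)
    (h0 : PowerSeries.coeff 0 f = 0) : f = 0 := by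
  ext1 d
  rw [map_zero]
  induction d with
  | zero => exact h0
  | succ d ih =>
    have recursion := ((mem_solutionSpace_iff f).mp hf).2 d
    rw [ih, map_zero, Module.End.pow_apply] at recursion
    exact (shiftDeriv_injective d.succ_ne_zero).iterate 4
      (recursion.trans (iterate_map_zero _ 4).symm)

theorem natDegree_lt_of_iterate_derivative_eq_zero {R : Type*} [Semiring R] [IsAddTorsionFree R]
    {p : R[X]} {k : ℕ} (hk : 0 < k) (hp : derivative^[k] p = 0) : p.natDegree < k := by
  by_contra! hle
  have hcoeff := congrArg (fun g => g.coeff (p.natDegree - k)) hp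
  simp only [Polynomial.coeff_iterate_derivative, Polynomial.coeff_zero, Nat.sub_add_cancel hle]
    at hcoeff
  have hdesc : p.natDegree.descFactorial k ≠ 0 := (Nat.descFactorial_pos.mpr hle).ne'
  have hzero : p = 0 :=
    Polynomial.leadingCoeff_eq_zero.mp ((smul_eq_zero_iff_right hdesc).mp hcoeff)
  rw [hzero, Polynomial.natDegree_zero] at hle
  exact hk.not_ge hle

/-- The component along `f` of the Frobenius-type series `e^{Pℓ/h} y`. -/
def expLogComponent (h : K) (f : QuinticAlg K →ₗ[K] K) : QuinticAlg K →ₗ[K] K[X] :=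
  polyMapₗ f ∘ₗ LinearMap.mulLeft K (expLog h) ∘ₗ (Polynomial.CAlgHom (R := K)).toLinearMap

theorem expLogComponent_apply (h : K) (f : QuinticAlg K →ₗ[K] K) (y : QuinticAlg K) :
    expLogComponent h f y = polyMap f (expLog h * Polynomial.C y) :=
  rfl

theorem shiftDeriv_expLogComponent [CharZero K] (h : K) (f : QuinticAlg K →ₗ[K] K) (d : ℕ)
    (y : QuinticAlg K) :
    shiftDeriv K d (expLogComponent h f y) =
      expLogComponent h f ((h⁻¹ • clsP K + (d : QuinticAlg K)) * y) := by
  have derivative_eq : derivative (expLogComponent h f y) =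
      expLogComponent h f (h⁻¹ • clsP K * y) := by
    rw [expLogComponent_apply, expLogComponent_apply, derivative_polyMap, Polynomial.derivative_mul,
      derivative_expLog, Polynomial.derivative_C, mul_zero, add_zero, Polynomial.C_mul,
      mul_right_comm, mul_comm]
  rw [add_mul, map_add, ← derivative_eq, ← nsmul_eq_mul, map_nsmul, add_comm,
    ← Nat.cast_smul_eq_nsmul K]
  rfl

theorem aeval_shiftDeriv_expLogComponent [CharZero K] (h : K) (f : QuinticAlg K →ₗ[K] K) (d : ℕ)
    (p : K[X]) (y : QuinticAlg K) :
    Polynomial.aeval (shiftDeriv K d) p (expLogComponent h f y) =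
      expLogComponent h f (Polynomial.aeval (h⁻¹ • clsP K + (d : QuinticAlg K)) p * y) := by
  rw [← map_aeval_apply_of_forall (S := Algebra.lmul K _ (h⁻¹ • clsP K + (d : QuinticAlg K)))
    (expLogComponent h f) (fun y => (shiftDeriv_expLogComponent h f d y).symm),
    Polynomial.aeval_algHom_apply]
  rfl

theorem hyperCoeff_zero (h : K) : hyperCoeff h 0 = 1 := by
  simp [hyperCoeff]

theorem isUnit_prod_clsP_add [CharZero K] {h : K} (hh : h ≠ 0) (d : ℕ) :
    IsUnit (∏ m ∈ Finset.Icc 1 d, (clsP K + algebraMap K (QuinticAlg K) (m * h))) :=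
  IsUnit.prod_iff.mpr fun _ hm => isUnit_clsP_add
    (mul_ne_zero (Nat.cast_ne_zero.mpr (Nat.one_le_iff_ne_zero.mp (Finset.mem_Icc.mp hm).1)) hh)

theorem hyperCoeff_mul_prod_pow [CharZero K] {h : K} (hh : h ≠ 0) (d : ℕ) :
    hyperCoeff h d * (∏ m ∈ Finset.Icc 1 d, (clsP K + algebraMap K (QuinticAlg K) (m * h))) ^ 5 =
      ∏ m ∈ Finset.Icc 1 (5 * d), (5 * clsP K + algebraMap K (QuinticAlg K) (m * h)) := by
  rw [hyperCoeff, Finset.prod_pow, mul_assoc,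
    Ring.inverse_mul_cancel _ ((isUnit_prod_clsP_add hh d).pow 5), mul_one]

theorem hyperCoeff_succ_mul [CharZero K] {h : K} (hh : h ≠ 0) (d : ℕ) :
    hyperCoeff h (d + 1) * (clsP K + algebraMap K (QuinticAlg K) ((d + 1 : ℕ) * h)) ^ 5 =
      hyperCoeff h d * ∏ i ∈ Finset.range 5,
        (5 * clsP K + algebraMap K (QuinticAlg K) ((5 * d + (i + 1) : ℕ) * h)) := by
  have prod_numerator : ∏ m ∈ Finset.Icc 1 (5 * (d + 1)),
      (5 * clsP K + algebraMap K (QuinticAlg K) ((m : ℕ) * h)) =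
      (∏ m ∈ Finset.Icc 1 (5 * d), (5 * clsP K + algebraMap K (QuinticAlg K) ((m : ℕ) * h))) *
        ∏ i ∈ Finset.range 5,
          (5 * clsP K + algebraMap K (QuinticAlg K) ((5 * d + (i + 1) : ℕ) * h)) := by
    simp only [show 5 * (d + 1) = 5 * d + 1 + 1 + 1 + 1 + 1 from rfl,
      Finset.prod_Icc_succ_top (Nat.le_add_left 1 _), Finset.prod_range_succ,
      Finset.prod_range_zero, one_mul, ← add_assoc, mul_assoc]
  apply ((isUnit_prod_clsP_add hh d).pow 5).mul_left_injective
  change _ * _ * _ = _ * _ * _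
  rw [mul_assoc, mul_comm (_ ^ 5), ← mul_pow, ← Finset.prod_Icc_succ_top (Nat.le_add_left 1 d),
    hyperCoeff_mul_prod_pow hh, prod_numerator, ← hyperCoeff_mul_prod_pow hh, mul_right_comm]

theorem hyperCoeff_succ [CharZero K] {h : K} (hh : h ≠ 0) (d : ℕ) :
    (h⁻¹ • clsP K + ((d + 1 : ℕ) : QuinticAlg K)) ^ 4 * hyperCoeff h (d + 1) =
      Polynomial.aeval (h⁻¹ • clsP K + (d : QuinticAlg K)) (picardFuchsPoly K) *
        hyperCoeff h d := by
  have isUnit_h : IsUnit (algebraMap K (QuinticAlg K) h) := (IsUnit.mk0 h hh).map _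
  have clsP_eq : clsP K = algebraMap K (QuinticAlg K) h * (h⁻¹ • clsP K) := by
    rw [← Algebra.smul_def, smul_inv_smul₀ hh]
  have isUnit_top := isUnit_clsP_add (mul_ne_zero (Nat.cast_ne_zero.mpr d.succ_ne_zero) hh)
  have recursion := hyperCoeff_succ_mul hh d
  simp only [picardFuchsPoly, map_mul, map_add, map_ofNat, map_one, Polynomial.aeval_X]
  simp only [Finset.prod_range_succ, Finset.prod_range_zero, map_mul, map_natCast]
    at recursion isUnit_top
  rw [clsP_eq] at recursion isUnit_top
  generalize h⁻¹ • clsP K = θ at *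
  apply ((isUnit_h.pow 4).mul isUnit_top).mul_left_injective
  push_cast at recursion ⊢
  linear_combination recursion

theorem coeff_ISeries (h : K) (d : ℕ) :
    PowerSeries.coeff d (ISeries h) = expLog h * Polynomial.C (hyperCoeff h d) := by
  rw [ISeries, PowerSeries.coeff_C_mul, PowerSeries.coeff_mk]

theorem coeff_IComponent (h : K) (j : Fin 4) (d : ℕ) :
    PowerSeries.coeff d (IComponent h j) = expLogComponent h (comp j) (hyperCoeff h d) := by
  rw [IComponent, PowerSeries.coeff_mk, coeff_ISeries, expLogComponent_apply]

theorem IComponent_mem_solutionSpace [CharZero K] {h : K} (hh : h ≠ 0) (j : Fin 4) :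
    IComponent h j ∈ solutionSpace K := by
  have shiftDeriv_pow (d : ℕ) (y : QuinticAlg K) :
      (shiftDeriv K d ^ 4) (expLogComponent h (comp j) y) =
        expLogComponent h (comp j) ((h⁻¹ • clsP K + (d : QuinticAlg K)) ^ 4 * y) := by
    have := aeval_shiftDeriv_expLogComponent h (comp j) d (Polynomial.X ^ 4) y
    rwa [map_pow, map_pow, Polynomial.aeval_X, Polynomial.aeval_X] at this
  simp only [mem_solutionSpace_iff, coeff_IComponent, shiftDeriv_pow,
    aeval_shiftDeriv_expLogComponent]
  refine ⟨?_, fun d => congrArg _ (hyperCoeff_succ hh d)⟩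
  rw [Nat.cast_zero, add_zero, _root_.smul_pow, clsP_pow_four, smul_zero, zero_mul, map_zero]

theorem coeff_zero_IComponent (h : K) (j : Fin 4) :
    PowerSeries.coeff 0 (IComponent h j) =
      Polynomial.monomial (j : ℕ) (((j : ℕ).factorial : K)⁻¹ * h⁻¹ ^ (j : ℕ)) := by
  ext n
  rw [coeff_IComponent, expLogComponent_apply, coeff_polyMap, hyperCoeff_zero, map_one,
    mul_one, coeff_expLog, comp_algebraMap_mul_clsP_pow j.2, Polynomial.coeff_monomial]
  exact ite_congr rfl (fun hjn => by rw [hjn]) fun _ => rfl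

theorem coeff_zero_sum_smul_IComponent (h : K) (c : Fin 4 → K) :
    PowerSeries.coeff 0 (∑ j, c j • IComponent h j) =
      ∑ j : Fin 4, Polynomial.monomial (j : ℕ)
        (c j * (((j : ℕ).factorial : K)⁻¹ * h⁻¹ ^ (j : ℕ))) := by
  simp only [map_sum, PowerSeries.coeff_smul, coeff_zero_IComponent, Polynomial.smul_monomial,
    smul_eq_mul]

theorem linearIndependent_IComponent [CharZero K] {h : K} (hh : h ≠ 0) :
    LinearIndependent K (IComponent h) := by
  rw [Fintype.linearIndependent_iff]
  intro g hg i
  have hcoeff := congrArg (fun f => (PowerSeries.coeff 0 f).coeff (i : ℕ)) hg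
  simp only [coeff_zero_sum_smul_IComponent, Polynomial.finsetSum_coeff, Polynomial.coeff_monomial,
    Fin.val_inj, map_zero, Polynomial.coeff_zero] at hcoeff
  rw [Finset.sum_ite_eq' Finset.univ i, if_pos (Finset.mem_univ _)] at hcoeff
  have factorial_ne_zero : ((i : ℕ).factorial : K) ≠ 0 :=
    Nat.cast_ne_zero.mpr (Nat.factorial_ne_zero _)
  exact (mul_eq_zero.mp hcoeff).resolve_right
    (mul_ne_zero (inv_ne_zero factorial_ne_zero) (pow_ne_zero _ (inv_ne_zero hh)))

theorem exists_coeff_zero_eq_sum [CharZero K] {h : K} (hh : h ≠ 0) {f : K[X]⟦X⟧}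
    (hf : f ∈ solutionSpace K) :
    ∃ c : Fin 4 → K,
      PowerSeries.coeff 0 f = PowerSeries.coeff 0 (∑ j, c j • IComponent h j) := by
  have hderiv : derivative^[4] (PowerSeries.coeff 0 f) = 0 := by
    simpa [shiftDeriv, Module.End.pow_apply] using ((mem_solutionSpace_iff f).mp hf).1
  refine ⟨fun j => (PowerSeries.coeff 0 f).coeff j * ((j : ℕ).factorial * h ^ (j : ℕ)), ?_⟩
  rw [coeff_zero_sum_smul_IComponent]
  conv_lhs => rw [Polynomial.as_sum_range' _ 4
    (natDegree_lt_of_iterate_derivative_eq_zero four_pos hderiv), Finset.sum_range]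
  refine Finset.sum_congr rfl fun j _ => congrArg _ ?_
  have factorial_ne_zero : ((j : ℕ).factorial : K) ≠ 0 :=
    Nat.cast_ne_zero.mpr (Nat.factorial_ne_zero _)
  rw [inv_pow]
  field_simp

theorem span_IComponent [CharZero K] {h : K} (hh : h ≠ 0) :
    Submodule.span K (Set.range (IComponent h)) = solutionSpace K := by
  refine le_antisymm (Submodule.span_le.mpr ?_) fun f hf => ?_
  · rintro _ ⟨j, rfl⟩
    exact IComponent_mem_solutionSpace hh j
  · obtain ⟨c, hc⟩ := exists_coeff_zero_eq_sum hh hf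
    have sum_mem : ∑ j, c j • IComponent h j ∈ solutionSpace K :=
      Submodule.sum_mem _ fun j _ => Submodule.smul_mem _ _ (IComponent_mem_solutionSpace hh j)
    have hdiff : f - ∑ j, c j • IComponent h j = 0 :=
      eq_zero_of_mem_solutionSpace (Submodule.sub_mem _ hf sum_mem) (by rw [map_sub, hc, sub_self])
    rw [sub_eq_zero.mp hdiff]
    exact Submodule.sum_mem _ fun j _ => Submodule.smul_mem _ _ (Submodule.subset_span ⟨j, rfl⟩)

end DifferentialEquation

/-! ### Residues at the fixed points -/

theorem prod_range_erase_sub {M : Type*} [CommMonoid M] (f : ℤ → M) (a b : ℕ) :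
    ∏ j ∈ (Finset.range (a + b + 1)).erase a, f (a - j) =
      (∏ m ∈ Finset.Icc 1 a, f m) * ∏ m ∈ Finset.Icc 1 b, f (-m) := by
  have disjoint : Disjoint (Finset.range a) (Finset.Icc (a + 1) (a + b)) :=
    Finset.disjoint_left.mpr fun j => by simp only [Finset.mem_range, Finset.mem_Icc]; omega
  have erase_eq : (Finset.range (a + b + 1)).erase a =
      Finset.range a ∪ Finset.Icc (a + 1) (a + b) := by
    ext j
    simp only [Finset.mem_erase, Finset.mem_union, Finset.mem_range, Finset.mem_Icc]
    omega
  rw [erase_eq, Finset.prod_union disjoint]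
  congr 1
  · refine Finset.prod_nbij' (a - ·) (a - ·) ?_ ?_ ?_ ?_ fun j hj => ?_
    all_goals simp only [Finset.mem_range, Finset.mem_Icc] at *
    any_goals omega
    rw [Nat.cast_sub hj.le]
  · refine Finset.prod_nbij' (· - a) (· + a) ?_ ?_ ?_ ?_ fun j hj => ?_
    all_goals simp only [Finset.mem_Icc] at *
    any_goals omega
    rw [Nat.cast_sub (by omega), neg_sub]

section FixedPoints

variable {K : Type*} [Field K]

/-- The substitution `p = P + c`: the restriction of a polynomial in `p` to the component of the
fixed locus on which the weight is `c`, where `P` is the hyperplane class of that `ℂP^4`. -/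
def restrictAt (c : K) : K[X] →ₐ[K] QuinticAlg K :=
  Polynomial.aeval (clsP K + algebraMap K (QuinticAlg K) c)

theorem restrictAt_X (c : K) :
    restrictAt c Polynomial.X = clsP K + algebraMap K (QuinticAlg K) c :=
  Polynomial.aeval_X _

theorem restrictAt_C (c a : K) :
    restrictAt c (Polynomial.C a) = algebraMap K (QuinticAlg K) a :=
  Polynomial.aeval_C _ a

theorem restrictAt_X_sub_C (c a : K) :
    restrictAt c (Polynomial.X - Polynomial.C a) =
      clsP K + algebraMap K (QuinticAlg K) (c - a) := by
  rw [map_sub, restrictAt_X, restrictAt_C, map_sub, add_sub_assoc]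

theorem restrictAt_X_sub_C_self_pow_four (c : K) :
    restrictAt c ((Polynomial.X - Polynomial.C c) ^ 4) = 0 := by
  rw [map_pow, restrictAt_X_sub_C, sub_self, map_zero, add_zero, clsP_pow_four]

theorem restrictAt_eq_mk_taylor (c : K) (F : K[X]) :
    restrictAt c F = AdjoinRoot.mk (Polynomial.X ^ 4 : K[X]) (Polynomial.taylor c F) := by
  rw [Polynomial.taylor_apply, ← AdjoinRoot.aeval_eq, Polynomial.aeval_comp, map_add,
    Polynomial.aeval_X, Polynomial.aeval_C]
  rfl

theorem coeff_taylor_of_natDegree_le {R : Type*} [CommRing R] (c : R) {F : R[X]} {n : ℕ}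
    (hF : F.natDegree ≤ n) : (Polynomial.taylor c F).coeff n = F.coeff n := by
  rcases hF.eq_or_lt with rfl | hlt
  · exact Polynomial.coeff_taylor_natDegree c F
  · rw [Polynomial.coeff_eq_zero_of_natDegree_lt hlt, Polynomial.coeff_eq_zero_of_natDegree_lt
      (by rwa [Polynomial.natDegree_taylor])]

theorem resInfty_X_sub_C_pow_four (c : K) (F : K[X]) :
    resInfty ((Polynomial.X - Polynomial.C c) ^ 4) F = comp 3 (restrictAt c F) := by
  have monic : ((Polynomial.X - Polynomial.C c) ^ 4).Monic := (Polynomial.monic_X_sub_C c).pow 4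
  have natDegree_eq : ((Polynomial.X - Polynomial.C c) ^ 4).natDegree = 4 := by
    rw [Polynomial.natDegree_pow, Polynomial.natDegree_X_sub_C]
  have natDegree_rem : (F %ₘ (Polynomial.X - Polynomial.C c) ^ 4).natDegree < 4 :=
    (Polynomial.natDegree_modByMonic_lt F monic fun h => by simp [h] at natDegree_eq).trans_eq
      natDegree_eq
  conv_rhs => rw [← Polynomial.modByMonic_add_div F ((Polynomial.X - Polynomial.C c) ^ 4)]
  rw [map_add, map_mul, restrictAt_X_sub_C_self_pow_four, zero_mul, add_zero,
    restrictAt_eq_mk_taylor, comp_mk (by norm_num),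
    coeff_taylor_of_natDegree_le c (Nat.le_of_lt_succ natDegree_rem), resInfty_apply, natDegree_eq]

theorem resInfty_prod_X_sub_C_pow_four {ι : Type*} [DecidableEq ι] {s : Finset ι} {c : ι → K}
    (hc : Set.InjOn c s) (F : K[X]) :
    resInfty (∏ i ∈ s, (Polynomial.X - Polynomial.C (c i)) ^ 4) F =
      ∑ i ∈ s, comp 3 (restrictAt (c i) F *
        Ring.inverse (restrictAt (c i)
          (∏ j ∈ s.erase i, (Polynomial.X - Polynomial.C (c j)))) ^ 4) := by
  have coprime (i) (hi : i ∈ s) : IsCoprime ((Polynomial.X - Polynomial.C (c i)) ^ 4)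
      (∏ j ∈ s.erase i, (Polynomial.X - Polynomial.C (c j)) ^ 4) :=
    IsCoprime.prod_right fun j hj => IsCoprime.pow <|
      Polynomial.isCoprime_X_sub_C_of_isUnit_sub <| IsUnit.mk0 _ <| sub_ne_zero.mpr fun h =>
        Finset.ne_of_mem_erase hj (hc hi (Finset.mem_of_mem_erase hj) h).symm
  choose! v u huv using coprime
  rw [resInfty_prod s (u := u) (fun i _ => (Polynomial.monic_X_sub_C (c i)).pow 4)
    fun i hi => ⟨v i, by rw [← huv i hi]; ring⟩]
  refine Finset.sum_congr rfl fun i hi => ?_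
  have restrictAt_u_mul : restrictAt (c i) (u i) * restrictAt (c i)
      (∏ j ∈ s.erase i, (Polynomial.X - Polynomial.C (c j))) ^ 4 = 1 := by
    rw [← map_pow, ← Finset.prod_pow, ← map_mul, eq_sub_of_add_eq' (huv i hi), map_sub, map_mul,
      restrictAt_X_sub_C_self_pow_four, mul_zero, sub_zero, map_one]
  rw [resInfty_X_sub_C_pow_four, map_mul, Ring.inverse_pow]
  refine congrArg (comp 3) ((Ring.eq_mul_inverse_iff_mul_eq _ _ _
    (.of_mul_eq_one_right _ restrictAt_u_mul)).mpr ?_)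
  rw [mul_assoc, restrictAt_u_mul, mul_one]

/-- The Euler class `∏_{k ≤ 5d} (5p - kħ)` of `LV_d` as a polynomial in `p`. -/
def eulerPoly (h : K) (d : ℕ) : K[X] :=
  ∏ j ∈ Finset.range (5 * d + 1), (5 * Polynomial.X - Polynomial.C (j * h))

theorem five_mul_X_sub_C_five_mul (c : K) :
    5 * Polynomial.X - Polynomial.C (5 * c) = 5 * (Polynomial.X - Polynomial.C c) := by
  rw [Polynomial.C_mul, map_ofNat, mul_sub]

theorem prod_X_sub_C_dvd_eulerPoly (h : K) (d : ℕ) :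
    ∏ k ∈ Finset.range (d + 1), (Polynomial.X - Polynomial.C (k * h)) ∣ eulerPoly h d := by
  have subset : (Finset.range (d + 1)).map ⟨(5 * ·), mul_right_injective₀ (by norm_num)⟩ ⊆
      Finset.range (5 * d + 1) := fun j hj => by
    obtain ⟨k, hk, rfl⟩ := Finset.mem_map.mp hj
    simp only [Finset.mem_range, Function.Embedding.coeFn_mk] at *
    omega
  refine dvd_trans ?_ (Finset.prod_dvd_prod_of_subset _ _ _ subset)
  rw [Finset.prod_map]
  refine Finset.prod_dvd_prod_of_dvd _ _ fun k _ => ⟨5, ?_⟩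
  rw [Function.Embedding.coeFn_mk, Nat.cast_mul, Nat.cast_ofNat, mul_assoc,
    five_mul_X_sub_C_five_mul, mul_comm]

theorem restrictAt_prod_erase (h : K) (k b : ℕ) :
    restrictAt (k * h) (∏ j ∈ (Finset.range (k + b + 1)).erase k,
        (Polynomial.X - Polynomial.C (j * h))) =
      (∏ m ∈ Finset.Icc 1 k, (clsP K + algebraMap K (QuinticAlg K) (m * h))) *
        ∏ m ∈ Finset.Icc 1 b, (clsP K + algebraMap K (QuinticAlg K) (m * -h)) := by
  have key := prod_range_erase_sub
    (fun z : ℤ => clsP K + algebraMap K (QuinticAlg K) (z * h)) k b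
  simp only [Int.cast_sub, Int.cast_neg, Int.cast_natCast, neg_mul_comm, sub_mul] at key
  simp only [map_prod, restrictAt_X_sub_C]
  exact key

theorem restrictAt_eulerPoly_erase (h : K) (k b : ℕ) :
    restrictAt (k * h) (∏ j ∈ (Finset.range (5 * (k + b) + 1)).erase (5 * k),
        (5 * Polynomial.X - Polynomial.C (j * h))) =
      (∏ m ∈ Finset.Icc 1 (5 * k), (5 * clsP K + algebraMap K (QuinticAlg K) (m * h))) *
        ∏ m ∈ Finset.Icc 1 (5 * b), (5 * clsP K + algebraMap K (QuinticAlg K) (m * -h)) := by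
  have factor (j : ℕ) : restrictAt (k * h) (5 * Polynomial.X - Polynomial.C (j * h)) =
      5 * clsP K + algebraMap K (QuinticAlg K) ((5 * k : ℕ) * h - j * h) := by
    rw [map_sub, map_mul, map_ofNat, restrictAt_X, restrictAt_C, mul_add, map_sub, Nat.cast_mul,
      mul_assoc, map_mul _ ((5 : ℕ) : K), map_natCast, Nat.cast_ofNat, add_sub_assoc]
  have key := prod_range_erase_sub
    (fun z : ℤ => 5 * clsP K + algebraMap K (QuinticAlg K) (z * h)) (5 * k) (5 * b)
  simp only [Int.cast_sub, Int.cast_neg, Int.cast_natCast, neg_mul_comm, sub_mul] at key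
  simp only [map_prod, factor, mul_add 5 k b]
  exact key

theorem restrictAt_eulerPoly_div [CharZero K] {h : K} (hh : h ≠ 0) (k b : ℕ) {G : K[X]}
    (hG : eulerPoly h (k + b) =
      (∏ j ∈ Finset.range (k + b + 1), (Polynomial.X - Polynomial.C (j * h))) * G) :
    restrictAt (k * h) G * Ring.inverse (restrictAt (k * h)
        (∏ j ∈ (Finset.range (k + b + 1)).erase k, (Polynomial.X - Polynomial.C (j * h)))) ^ 4 =
      5 * (hyperCoeff h k * hyperCoeff (-h) b) := by
  have hk : k ∈ Finset.range (k + b + 1) := by simp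
  have h5k : 5 * k ∈ Finset.range (5 * (k + b) + 1) := by simp
  have cancelled : (∏ j ∈ (Finset.range (k + b + 1)).erase k,
      (Polynomial.X - Polynomial.C (j * h))) * G =
      5 * ∏ j ∈ (Finset.range (5 * (k + b) + 1)).erase (5 * k),
        (5 * Polynomial.X - Polynomial.C (j * h)) := by
    apply mul_left_cancel₀ (Polynomial.X_sub_C_ne_zero (k * h))
    rw [eulerPoly, ← Finset.mul_prod_erase _ _ hk, ← Finset.mul_prod_erase _ _ h5k, Nat.cast_mul,
      Nat.cast_ofNat, mul_assoc 5 (k : K), five_mul_X_sub_C_five_mul] at hG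
    rw [← mul_assoc, ← hG]
    ring
  have restricted := congrArg (restrictAt (k * h)) cancelled
  rw [map_mul, map_mul, map_ofNat, restrictAt_eulerPoly_erase, restrictAt_prod_erase,
    ← hyperCoeff_mul_prod_pow hh, ← hyperCoeff_mul_prod_pow (neg_ne_zero.mpr hh)] at restricted
  have isUnit := (isUnit_prod_clsP_add hh k).mul (isUnit_prod_clsP_add (neg_ne_zero.mpr hh) b)
  rw [restrictAt_prod_erase, Ring.inverse_pow, eq_comm,
    Ring.eq_mul_inverse_iff_mul_eq _ _ _ (isUnit.pow 4)]
  apply isUnit.mul_left_cancel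
  rw [restricted]
  ring

theorem resInfty_mul_eulerPoly [CharZero K] {h : K} (hh : h ≠ 0) (d : ℕ) (F : K[X]) :
    resInfty ((∏ k ∈ Finset.range (d + 1), (Polynomial.X - Polynomial.C (k * h))) ^ 5)
        (F * eulerPoly h d) =
      ∑ k ∈ Finset.range (d + 1), quinticInt (restrictAt (k * h) F *
        (hyperCoeff h k * hyperCoeff (-h) (d - k))) := by
  obtain ⟨G, hG⟩ := prod_X_sub_C_dvd_eulerPoly h d
  have monic (n : ℕ) :
      ((∏ k ∈ Finset.range (d + 1), (Polynomial.X - Polynomial.C (k * h))) ^ n).Monic :=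
    (Polynomial.monic_prod_of_monic _ _ fun _ _ => Polynomial.monic_X_sub_C _).pow n
  have injOn : Set.InjOn (fun k : ℕ => (k : K) * h) (Finset.range (d + 1)) :=
    ((mul_left_injective₀ hh).comp Nat.cast_injective).injOn
  rw [hG, mul_left_comm, pow_succ', resInfty_mul_mul (by simpa using monic 1) (monic 4),
    ← Finset.prod_pow, resInfty_prod_X_sub_C_pow_four injOn]
  refine Finset.sum_congr rfl fun k hk => ?_
  obtain ⟨b, rfl⟩ := Nat.exists_eq_add_of_le (Finset.mem_range_succ_iff.mp hk)
  rw [map_mul (restrictAt _), mul_assoc, restrictAt_eulerPoly_div hh k b hG,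
    Nat.add_sub_cancel_left, mul_left_comm, quinticInt, LinearMap.smul_apply, ← map_smul,
    Algebra.smul_def, map_ofNat]

end FixedPoints

/-! ### The pairing of the hypergeometric series -/

theorem algebraMap_rat_inv_natCast {K A : Type*} [Field K] [CharZero K] [CommRing A] [Algebra K A]
    [Algebra ℚ A] (n : ℕ) : algebraMap ℚ A (n : ℚ)⁻¹ = algebraMap K A (n : K)⁻¹ := by
  have factors : algebraMap ℚ A = (algebraMap K A).comp (algebraMap ℚ K) := Subsingleton.elim _ _
  rw [factors, RingHom.comp_apply, map_inv₀, map_natCast]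

theorem isNilpotent_C_mul_X {A : Type*} [CommRing A] {a : A} (ha : IsNilpotent a) :
    IsNilpotent (PowerSeries.C a * PowerSeries.X) :=
  (Commute.all _ _).isNilpotent_mul_right (ha.map PowerSeries.C)

theorem exp_C_mul_X {A : Type*} [CommRing A] [Algebra ℚ A] {a : A} (ha : IsNilpotent a) :
    IsNilpotent.exp (PowerSeries.C a * PowerSeries.X) =
      PowerSeries.rescale a (PowerSeries.exp A) := by
  obtain ⟨k, hk⟩ := ha
  have pow_eq_zero : (PowerSeries.C a * PowerSeries.X) ^ k = 0 := by
    rw [mul_pow, ← map_pow, hk, map_zero, zero_mul]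
  ext n
  have coeff_term (i : ℕ) : PowerSeries.coeff n
      ((i.factorial : ℚ)⁻¹ • (PowerSeries.C a * PowerSeries.X) ^ i) =
      if n = i then a ^ n * algebraMap ℚ A (n.factorial : ℚ)⁻¹ else 0 := by
    rw [PowerSeries.coeff_smul, mul_pow, ← map_pow, PowerSeries.coeff_C_mul,
      PowerSeries.coeff_X_pow]
    split_ifs with h
    · rw [h, mul_one, Algebra.smul_def, mul_comm]
    · rw [mul_zero, smul_zero]
  rw [IsNilpotent.exp_eq_sum pow_eq_zero, map_sum, PowerSeries.coeff_rescale, PowerSeries.coeff_exp,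
    one_div, Finset.sum_congr rfl fun i _ => coeff_term i, Finset.sum_ite_eq, ite_eq_left_iff,
    Finset.mem_range, not_lt]
  intro hn
  rw [pow_eq_zero_of_le hn hk, zero_mul]

section Pairing

variable {K : Type*} [Field K]

theorem C_smul_clsP_mul_X_pow_four (a : K) :
    (Polynomial.C (a • clsP K) * Polynomial.X) ^ 4 = 0 := by
  rw [mul_pow, ← map_pow, _root_.smul_pow, clsP_pow_four, smul_zero, map_zero, zero_mul]

theorem expLog_eq_exp [CharZero K] (h : K) :
    expLog h = IsNilpotent.exp (Polynomial.C (h⁻¹ • clsP K) * Polynomial.X) := by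
  rw [IsNilpotent.exp_eq_sum (C_smul_clsP_mul_X_pow_four h⁻¹), expLog]
  refine Finset.sum_congr rfl fun j _ => ?_
  rw [Algebra.smul_def, algebraMap_rat_inv_natCast (K := K), mul_pow, ← Polynomial.C_pow,
    ← mul_assoc, Polynomial.algebraMap_apply, ← Polynomial.C_mul,
    Polynomial.C_mul_X_pow_eq_monomial, Algebra.smul_def, mul_pow,
    map_mul (algebraMap K (QuinticAlg K)), map_pow (algebraMap K _), mul_assoc]

theorem expLog_mul_expLog_neg [CharZero K] (h : K) : expLog h * expLog (-h) = 1 := by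
  rw [expLog_eq_exp, expLog_eq_exp, inv_neg, neg_smul, map_neg, neg_mul]
  exact IsNilpotent.exp_mul_exp_neg_self ⟨4, C_smul_clsP_mul_X_pow_four h⁻¹⟩

theorem expZ_eq_rescale [CharZero K] (a : K) :
    expZ a = PowerSeries.rescale (Polynomial.C (algebraMap K (QuinticAlg K) a))
      (PowerSeries.exp (QuinticAlg K)[X]) := by
  ext1 n
  rw [expZ, PowerSeries.coeff_mk, PowerSeries.coeff_rescale, PowerSeries.coeff_exp, one_div,
    algebraMap_rat_inv_natCast (K := K), map_mul, map_pow, mul_comm, Polynomial.algebraMap_apply]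

theorem eval₂_expLog [CharZero K] {h : K} (hh : h ≠ 0) :
    (expLog h).eval₂ ((PowerSeries.C (R := (QuinticAlg K)[X])).comp Polynomial.C)
      (PowerSeries.C Polynomial.X +
        PowerSeries.C (algebraMap K (QuinticAlg K)[X] h) * PowerSeries.X) =
    PowerSeries.C (expLog h) * PowerSeries.rescale (Polynomial.C (clsP K))
      (PowerSeries.exp (QuinticAlg K)[X]) := by
  have isNilpotent : IsNilpotent (Polynomial.C (h⁻¹ • clsP K) * Polynomial.X) :=
    ⟨4, C_smul_clsP_mul_X_pow_four h⁻¹⟩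
  have isNilpotent_C_clsP : IsNilpotent (Polynomial.C (clsP K)) :=
    isNilpotent_clsP.map Polynomial.C
  have smul_mul_algebraMap : Polynomial.C (h⁻¹ • clsP K) * algebraMap K (QuinticAlg K)[X] h =
      Polynomial.C (clsP K) := by
    rw [mul_comm, ← Algebra.smul_def, Polynomial.smul_C, smul_smul, mul_inv_cancel₀ hh, one_smul]
  have eval₂_exponent : Polynomial.eval₂ ((PowerSeries.C (R := (QuinticAlg K)[X])).comp
      Polynomial.C) (PowerSeries.C Polynomial.X +
        PowerSeries.C (algebraMap K (QuinticAlg K)[X] h) * PowerSeries.X)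
      (Polynomial.C (h⁻¹ • clsP K) * Polynomial.X) =
      PowerSeries.C (Polynomial.C (h⁻¹ • clsP K) * Polynomial.X) +
        PowerSeries.C (Polynomial.C (clsP K)) * PowerSeries.X := by
    rw [Polynomial.eval₂_mul, Polynomial.eval₂_C, Polynomial.eval₂_X, RingHom.comp_apply, mul_add,
      ← mul_assoc, ← map_mul, ← map_mul, smul_mul_algebraMap]
  rw [← Polynomial.coe_eval₂RingHom, expLog_eq_exp, IsNilpotent.map_exp isNilpotent,
    IsNilpotent.map_exp isNilpotent, ← exp_C_mul_X isNilpotent_C_clsP,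
    ← IsNilpotent.exp_add_of_commute (Commute.all _ _) (isNilpotent.map _)
      (isNilpotent_C_mul_X isNilpotent_C_clsP),
    Polynomial.coe_eval₂RingHom, eval₂_exponent]

theorem coeff_shiftQ_ISeries_mul_coeff_constZ_ISeries [CharZero K] {h : K} (hh : h ≠ 0)
    (a b : ℕ) :
    PowerSeries.coeff a (shiftQ h (ISeries h)) * PowerSeries.coeff b (constZ (ISeries (-h))) =
      PowerSeries.C (Polynomial.C (hyperCoeff h a * hyperCoeff (-h) b)) *
        PowerSeries.rescale (Polynomial.C (clsP K + algebraMap K (QuinticAlg K) (a * h)))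
          (PowerSeries.exp (QuinticAlg K)[X]) := by
  have C_expLog_mul : PowerSeries.C (expLog h) * PowerSeries.C (expLog (-h)) = 1 := by
    rw [← map_mul, expLog_mul_expLog_neg, map_one]
  rw [shiftQ, PowerSeries.coeff_mk, constZ, PowerSeries.coeff_map, coeff_ISeries, coeff_ISeries,
    Polynomial.eval₂_mul, Polynomial.eval₂_C, eval₂_expLog hh, expZ_eq_rescale,
    map_add Polynomial.C, ← PowerSeries.exp_mul_exp_eq_exp_add, RingHom.comp_apply,
    map_mul PowerSeries.C, map_mul Polynomial.C, map_mul PowerSeries.C]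
  linear_combination PowerSeries.C (Polynomial.C (hyperCoeff h a)) *
    PowerSeries.C (Polynomial.C (hyperCoeff (-h) b)) *
    PowerSeries.rescale (Polynomial.C (clsP K)) (PowerSeries.exp (QuinticAlg K)[X]) *
    PowerSeries.rescale (Polynomial.C (algebraMap K (QuinticAlg K) (a * h)))
      (PowerSeries.exp (QuinticAlg K)[X]) * C_expLog_mul

theorem coeff_C_mul_rescale_exp [CharZero K] (x y : QuinticAlg K) (n : ℕ) :
    PowerSeries.coeff n (PowerSeries.C (Polynomial.C y) *
      PowerSeries.rescale (Polynomial.C x) (PowerSeries.exp (QuinticAlg K)[X])) =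
      Polynomial.C (algebraMap K (QuinticAlg K) (n.factorial : K)⁻¹ * x ^ n * y) := by
  rw [PowerSeries.coeff_C_mul, PowerSeries.coeff_rescale, PowerSeries.coeff_exp, one_div,
    algebraMap_rat_inv_natCast (K := K), Polynomial.algebraMap_apply, ← Polynomial.C_pow,
    ← Polynomial.C_mul, ← Polynomial.C_mul, mul_comm y, mul_comm (x ^ n)]

theorem polyMap_C (f : QuinticAlg K →ₗ[K] K) (y : QuinticAlg K) :
    polyMap f (Polynomial.C y) = Polynomial.C (f y) := by
  ext n
  rw [coeff_polyMap, Polynomial.coeff_C, Polynomial.coeff_C, apply_ite f, map_zero]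

theorem coeff_pairingSeries_ISeries [CharZero K] {h : K} (hh : h ≠ 0) (d n : ℕ) :
    PowerSeries.coeff n (PowerSeries.coeff d
      (pairingSeries (shiftQ h (ISeries h)) (constZ (ISeries (-h))))) =
    Polynomial.C (resInfty
      ((∏ k ∈ Finset.range (d + 1), (Polynomial.X - Polynomial.C (k * h))) ^ 5)
      (Polynomial.C (n.factorial : K)⁻¹ * Polynomial.X ^ n * eulerPoly h d)) := by
  rw [pairingSeries, PowerSeries.coeff_mk, PowerSeries.coeff_mk, PowerSeries.coeff_mul, map_sum]
  simp only [coeff_shiftQ_ISeries_mul_coeff_constZ_ISeries hh, coeff_C_mul_rescale_exp]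
  rw [← map_sum, polyMap_C, map_sum, resInfty_mul_eulerPoly hh,
    Finset.Nat.sum_antidiagonal_eq_sum_range_succ_mk]
  simp only [map_mul, map_pow, restrictAt_C, restrictAt_X]

end Pairing

/-! ### The linear sigma-model -/

theorem prod_range_mul_div {M : Type*} [CommMonoid M] (f : ℕ → M) {n : ℕ} (hn : 0 < n) (d : ℕ) :
    ∏ j ∈ Finset.range (n * d), f (j / n) = (∏ k ∈ Finset.range d, f k) ^ n := by
  induction d with
  | zero => rw [mul_zero, Finset.prod_range_zero, Finset.prod_range_zero, one_pow]
  | succ d ih =>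
    have last_block (i) (hi : i ∈ Finset.range n) : f ((n * d + i) / n) = f d := by
      rw [Nat.mul_add_div hn, Nat.div_eq_of_lt (Finset.mem_range.mp hi), add_zero]
    rw [mul_add_one, Finset.prod_range_add, ih, Finset.prod_congr rfl last_block,
      Finset.prod_const, Finset.card_range, Finset.prod_range_succ, mul_pow]

theorem weightPoly_sigmaWeight (d : ℕ) :
    weightPoly (sigmaWeight d) =
      (∏ k ∈ Finset.range (d + 1), (Polynomial.X - Polynomial.C (k * Polynomial.X))) ^ 5 := by
  rw [← prod_range_mul_div _ (by norm_num), mul_add_one, Finset.prod_range]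
  rfl

/-- The integrand `p^n / n! · Euler(LV_d)` as a polynomial in `p` over `ℝ[ħ]`. -/
def sigmaPoly (d n : ℕ) : ℝ[X][X] :=
  Polynomial.C (Polynomial.C (n.factorial : ℝ)⁻¹) * Polynomial.X ^ n *
    ∏ k ∈ Finset.range (5 * d + 1), (5 * Polynomial.X - Polynomial.C (k * Polynomial.X))

theorem evalP_sigmaPoly (d n : ℕ) :
    evalP (sigmaWeight d) (sigmaPoly d n) = ((n.factorial : ℝ)⁻¹ • pLX d ^ n) * eulerLV d := by
  have evalP_factor (k : ℕ) : evalP (sigmaWeight d)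
      (5 * Polynomial.X - Polynomial.C (k * Polynomial.X)) =
      5 * pLX d - (k : EquivForm (5 * d + 4)) * hbarForm := by
    rw [map_sub, map_mul, map_ofNat, evalP_X, evalP_C, Polynomial.map_mul, Polynomial.map_natCast,
      Polynomial.map_X]
    rfl
  have prod_eq_list_prod : ∏ k ∈ Finset.range (5 * d + 1),
      (5 * Polynomial.X - Polynomial.C (k * Polynomial.X) : ℝ[X][X]) =
      ((List.range (5 * d + 1)).map fun k : ℕ =>
        5 * Polynomial.X - Polynomial.C (k * Polynomial.X)).prod := rfl
  rw [sigmaPoly, prod_eq_list_prod, map_mul, map_mul, map_pow, evalP_X, evalP_C, Polynomial.map_C,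
    map_list_prod, List.map_map, eulerLV, bind_pure_comp, List.map_eq_map, List.map_map,
    Algebra.smul_def]
  refine congrArg₂ _ rfl (congrArg List.prod (List.map_congr_left fun k _ => evalP_factor k))

theorem map_sigmaPoly (d n : ℕ) :
    (sigmaPoly d n).map (algebraMap ℝ[X] (RatFunc ℝ)) =
      Polynomial.C (n.factorial : RatFunc ℝ)⁻¹ * Polynomial.X ^ n * eulerPoly RatFunc.X d := by
  simp only [sigmaPoly, eulerPoly, Polynomial.map_mul, Polynomial.map_pow, Polynomial.map_prod,
    Polynomial.map_sub, Polynomial.map_X, Polynomial.map_C, Polynomial.map_ofNat,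
    Polynomial.map_natCast, RatFunc.algebraMap_C, RatFunc.algebraMap_X, map_mul, map_natCast,
    map_inv₀]

theorem algebraMap_equivIntegral_sigma (d n : ℕ) :
    algebraMap ℝ[X] (RatFunc ℝ)
      (equivIntegral (((n.factorial : ℝ)⁻¹ • pLX d ^ n) * eulerLV d)) =
    resInfty ((∏ k ∈ Finset.range (d + 1),
        (Polynomial.X - Polynomial.C ((k : RatFunc ℝ) * RatFunc.X))) ^ 5)
      (Polynomial.C (n.factorial : RatFunc ℝ)⁻¹ * Polynomial.X ^ n *
        eulerPoly RatFunc.X d) := by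
  have monic : (weightPoly (sigmaWeight d)).Monic :=
    Polynomial.monic_prod_of_monic _ _ fun _ _ => Polynomial.monic_X_sub_C _
  rw [← evalP_sigmaPoly, equivIntegral_evalP, map_resInfty _ monic, map_sigmaPoly,
    weightPoly_sigmaWeight]
  simp only [Polynomial.map_pow, Polynomial.map_prod, Polynomial.map_sub, Polynomial.map_X,
    Polynomial.map_C, Polynomial.map_mul, Polynomial.map_natCast, map_mul, map_natCast,
    RatFunc.algebraMap_X]

theorem map_LSeries_eq_pairingSeries :
    PowerSeries.map (PowerSeries.map
        (Polynomial.C.comp (algebraMap ℝ[X] (RatFunc ℝ)))) LSeries =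
      pairingSeries (shiftQ (RatFunc.X : RatFunc ℝ) (ISeries RatFunc.X))
        (constZ (ISeries (-RatFunc.X))) := by
  have : CharZero (RatFunc ℝ) :=
    charZero_of_injective_algebraMap (algebraMap ℝ (RatFunc ℝ)).injective
  ext1 d
  ext1 n
  rw [coeff_pairingSeries_ISeries RatFunc.X_ne_zero, ← algebraMap_equivIntegral_sigma,
    PowerSeries.coeff_map, PowerSeries.coeff_map, LSeries, PowerSeries.coeff_mk,
    PowerSeries.coeff_mk, RingHom.comp_apply]

/-! ### The intersection pairing -/

theorem pairing_mk {K : Type*} [Field K] (φ ψ : K[X]) :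
    pairing (AdjoinRoot.mk _ φ) (AdjoinRoot.mk _ ψ) = 5 * (φ * ψ).coeff 3 := by
  rw [pairing, ← map_mul, quinticInt, LinearMap.smul_apply, comp_mk (by norm_num), smul_eq_mul]

theorem resInfty_X_pow {R : Type*} [CommRing R] (n : ℕ) (F : R[X]) :
    resInfty (Polynomial.X ^ (n + 1)) F = F.coeff n := by
  nontriviality R
  conv_rhs => rw [← Polynomial.modByMonic_add_div F (Polynomial.X ^ (n + 1))]
  rw [Polynomial.coeff_add, Polynomial.coeff_X_pow_mul', if_neg n.lt_succ_self.not_ge, add_zero,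
    resInfty_apply, Polynomial.natDegree_X_pow, Nat.add_sub_cancel]

theorem weightPoly_zero (N : ℕ) :
    weightPoly (0 : Fin (N + 1) → ℕ) = Polynomial.X ^ (N + 1) := by
  simp [weightPoly]

theorem evalP_map_C {N : ℕ} (w : Fin (N + 1) → ℕ) (φ : ℝ[X]) :
    evalP w (φ.map Polynomial.C) = Polynomial.aeval (pForm w) φ := by
  induction φ using Polynomial.induction_on' with
  | add φ ψ hφ hψ => rw [Polynomial.map_add, map_add, map_add, hφ, hψ]
  | monomial n c =>
    rw [Polynomial.aeval_monomial, Polynomial.map_monomial, ← Polynomial.C_mul_X_pow_eq_monomial,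
      map_mul, map_pow, evalP_X, evalP_C, Polynomial.map_C]
    rfl

theorem equivIntegral_pairing (φ ψ : ℝ[X]) :
    equivIntegral (Polynomial.aeval (pForm (N := 4) 0) φ * Polynomial.aeval (pForm (N := 4) 0) ψ *
      (5 * pForm (N := 4) 0)) =
    Polynomial.C (pairing (AdjoinRoot.mk _ φ) (AdjoinRoot.mk _ ψ)) := by
  have integrand_eq : Polynomial.aeval (pForm (N := 4) 0) φ *
      Polynomial.aeval (pForm (N := 4) 0) ψ * (5 * pForm (N := 4) 0) =
      evalP (N := 4) 0 ((φ * ψ * (5 * Polynomial.X)).map Polynomial.C) := by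
    simp only [evalP_map_C, map_mul, map_ofNat, Polynomial.aeval_X]
  rw [integrand_eq, equivIntegral_evalP, weightPoly_zero, resInfty_X_pow, Polynomial.coeff_map,
    ← mul_assoc, Polynomial.coeff_mul_X, mul_comm, Polynomial.coeff_ofNat_mul, pairing_mk]

theorem circleIntegrable_aeval_mul (g : ℝ[X]) :
    CircleIntegrable (fun z : ℂ => Polynomial.aeval z g * (5 * z / z ^ 5)) 0 1 := by
  refine ContinuousOn.circleIntegrable zero_le_one <|
    (Polynomial.continuous_aeval g).continuousOn.mul <|
      ContinuousOn.div (by fun_prop) (by fun_prop) fun z hz => pow_ne_zero 5 ?_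
  exact ne_zero_of_mem_sphere one_ne_zero ⟨z, hz⟩

theorem circleIntegral_pow_mul (n : ℕ) :
    (∮ z in C(0, 1), z ^ n * (5 * z / z ^ 5)) =
      if n = 3 then 2 * (Real.pi : ℂ) * Complex.I * 5 else 0 := by
  have integrand_eq : Set.EqOn (fun z : ℂ => z ^ n * (5 * z / z ^ 5))
      (fun z => 5 * (z - 0) ^ ((n : ℤ) - 4)) (Metric.sphere 0 1) := fun z hz => by
    have hz0 : z ≠ 0 := ne_zero_of_mem_sphere one_ne_zero ⟨z, hz⟩
    simp only [sub_zero]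
    rw [zpow_sub₀ hz0, zpow_natCast, zpow_ofNat]
    field_simp
  rw [circleIntegral.integral_congr zero_le_one integrand_eq, circleIntegral.integral_const_mul]
  split_ifs with hn
  · subst hn
    norm_num only [zpow_neg_one]
    rw [circleIntegral.integral_sub_center_inv _ one_ne_zero, mul_comm]
  · rw [circleIntegral.integral_sub_zpow_of_ne (by omega), mul_zero]

theorem circleIntegral_aeval_mul (g : ℝ[X]) :
    (∮ z in C(0, 1), Polynomial.aeval z g * (5 * z / z ^ 5)) =
      2 * (Real.pi : ℂ) * Complex.I * (5 * g.coeff 3 : ℝ) := by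
  induction g using Polynomial.induction_on' with
  | add p q hp hq =>
    simp only [map_add, add_mul, Polynomial.coeff_add]
    rw [circleIntegral.integral_add (circleIntegrable_aeval_mul p) (circleIntegrable_aeval_mul q),
      hp, hq, ← mul_add, ← Complex.ofReal_add, mul_add]
  | monomial n c =>
    simp only [Polynomial.aeval_monomial, mul_assoc]
    rw [circleIntegral.integral_const_mul, circleIntegral_pow_mul, Polynomial.coeff_monomial]
    split_ifs
    · rw [Complex.coe_algebraMap, Complex.ofReal_mul, Complex.ofReal_ofNat]
      ring
    · simp

theorem circleIntegral_pairing (φ ψ : ℝ[X]) :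
    (2 * (Real.pi : ℂ) * Complex.I)⁻¹ *
      (∮ P in C(0, 1), Polynomial.aeval P φ * Polynomial.aeval P ψ * (5 * P / P ^ 5)) =
    (pairing (AdjoinRoot.mk _ φ) (AdjoinRoot.mk _ ψ) : ℝ) := by
  simp only [← map_mul]
  rw [circleIntegral_aeval_mul, inv_mul_cancel_left₀ Complex.two_pi_I_ne_zero, pairing_mk]

end

end QuinticMirror

theorem theoremA :
    -- the intersection pairing: integral over `ℂP^4` and residue
    (∀ φ ψ : Polynomial ℝ,
      QuinticMirror.equivIntegral
          (Polynomial.aeval (QuinticMirror.pForm (N := 4) 0) φ *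
            Polynomial.aeval (QuinticMirror.pForm (N := 4) 0) ψ *
            (5 * QuinticMirror.pForm (N := 4) 0)) =
        Polynomial.C (QuinticMirror.pairing (AdjoinRoot.mk _ φ) (AdjoinRoot.mk _ ψ)) ∧
      (2 * (Real.pi : ℂ) * Complex.I)⁻¹ *
          (∮ P in C(0, 1), Polynomial.aeval P φ * Polynomial.aeval P ψ * (5 * P / P ^ 5)) =
        (QuinticMirror.pairing (AdjoinRoot.mk _ φ) (AdjoinRoot.mk _ ψ) : ℝ)) ∧
    -- (a)
    PowerSeries.map (PowerSeries.map
        (Polynomial.C.comp (algebraMap (Polynomial ℝ) (RatFunc ℝ)))) QuinticMirror.LSeries =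
      QuinticMirror.pairingSeries
        (QuinticMirror.shiftQ (RatFunc.X : RatFunc ℝ) (QuinticMirror.ISeries RatFunc.X))
        (QuinticMirror.constZ (QuinticMirror.ISeries (-RatFunc.X))) ∧
    -- (b)
    (∀ (K : Type*) [Field K] [CharZero K] (h : K), h ≠ 0 →
      LinearIndependent K (QuinticMirror.IComponent h) ∧
      Submodule.span K (Set.range (QuinticMirror.IComponent h)) =
        QuinticMirror.solutionSpace K) := by
  exact ⟨fun φ ψ => ⟨QuinticMirror.equivIntegral_pairing φ ψ,
      QuinticMirror.circleIntegral_pairing φ ψ⟩,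
    QuinticMirror.map_LSeries_eq_pairingSeries,
    fun K _ _ h hh =>
      ⟨QuinticMirror.linearIndependent_IComponent hh, QuinticMirror.span_IComponent hh⟩⟩
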